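/- Let \(0<\mu<L<+\infty\) and \(q=\mu/L\). For a real Hilbert space \(\mathcal H\), let \(\mathcal F_{\mu,L}(\mathcal H)\) be the set of \(f:\mathcal H\to\mathbb R\) that are \(\mu\)-strongly convex and Fréchet differentiable with \(L\)-Lipschitz gradient, and let \(\mathcal F_{0,\infty}(\mathcal H)\) be the set of convex, proper, lower semicontinuous \(g:\mathcal H\to\mathbb R\cup\{+\infty\}\). For \(\gamma>0\) let \(\operatorname{Prox}_g^{\gamma}(x)=\operatorname{argmin}_{z\in\mathcal H}\bigl(g(z)+\tfrac1{2\gamma}\|x-z\|^2\bigr)\). Define \(A_0=0\) and, for \(k\ge 0\), \[ A_{k+1}=\frac{(1+q)A_k+2\bigl(1+\sqrt{(1+A_k)(1+qA_k)}\bigr)}{(1-q)^2},\qquad \beta_k=\frac{A_k}{(1-q)A_{k+1}},\qquad \delta_k=\sqrt{\frac{A_{k+1}}{1+qA_{k+1}}}. \] *Prox-ITEM*, started at \(x^0=z^0=u^0\in\mathcal H\), iterates for \(k=0,1,2,\dots\) \[ \begin{aligned} y^k&=(1-\beta_k)z^k+\beta_kx^k, & \bar z^{k+1}&=(1-q\delta_k)z^k+q\delta_ky^k-\tfrac{\delta_k}{L}\nabla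 f(y^k),\\ z^{k+1}&=\operatorname{Prox}_g^{\delta_k/L}(\bar z^{k+1}), & x^{k+1}&=y^k-\tfrac1L\nabla f(y^k)-\tfrac1{\delta_k}(\bar z^{k+1}-z^{k+1}). \end{aligned} \] For \(k\in\mathbb N_0\), let \(\mathcal A_{k,\mu,L}\) be the class of span-based methods with \(k\) gradient calls to \(f\) and any number of proximal calls to \(g\): a method \(\mathsf A\) assigns to every real Hilbert space \(\mathcal H\), \(f\in\mathcal F_{\mu,L}(\mathcal H)\), \(g\in\mathcal F_{0,\infty}(\mathcal H)\) and \(u^0\in\mathcal H\) a point \(\mathsf A(f,g,u^0)=u^k\in\mathcal H\) for which there are an integer \(m\ge k\), \(\theta\in\{0,1\}^{\{0,\dots,m-1\}}\) with \(\sum_{\ell}\theta_\ell=k\), numbers \(\gamma_\ell>0\), and points \(v^0=u^0,v^1,\dots,v^{m-1}\) such that, with \[ s^\ell=\begin{cases}\nabla f(v^\ell)&\text{if }\theta_\ell=1,\\ \gamma_\ell^{-1}\bigl(v^\ell-\operatorname{Prox}_g^{\gamma_\ell}(v^\ell)\bigr)&\text{if }\theta_\ell=0,\end{cases} \] one has \(v^\ell\in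 u^0+\operatorname{span}\{s^0,\dots,s^{\ell-1}\}\) for \(1\le\ell\le m-1\) and \(u^k\in u^0+\operatorname{span}\{s^0,\dots,s^{m-1}\}\), where \(\operatorname{span}\emptyset=\{0\}\). The choices of \(m,\theta,\gamma_\ell,v^\ell\) and \(u^k\) may depend on the instance. Define the worst-case relative squared distance to the solution \[ \mathcal R_{k,\mu,L}(\mathsf A)=\sup\frac{\|\mathsf A(f,g,u^0)-u^\star\|^2}{\|u^0-u^\star\|^2}\in[0,+\infty], \] where the supremum is over all real Hilbert spaces \(\mathcal H\), \(f\in\mathcal F_{\mu,L}(\mathcal H)\), \(g\in\mathcal F_{0,\infty}(\mathcal H)\), \(u^\star\in\operatorname{argmin}(f+g)\) and \(u^0\in\mathcal H\) with \(u^0\ne u^\star\). **Theorem.** For every \(k\in\mathbb N_0\), \[ \inf_{\mathsf A\in\mathcal A_{k,\mu,L}}\mathcal R_{k,\mu,L}(\mathsf A)=\frac1{1+qA_k}. \] Moreover, the infimum is attained by Prox-ITEM run for \(k\) iterations with input \(u^0\) and output \(u^k=z^k\); in particular this method belongs to \(\mathcal A_{k,\mu,L}\). -/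

import Mathlib

open Set

universe u

namespace ProxItem

noncomputable section

section Classes

variable {H : Type u} [NormedAddCommGroup H] [InnerProductSpace ℝ H] [CompleteSpace H]

/-- The class of `μ`-strongly convex, `L`-smooth functions on `H`. Such functions are finite
everywhere, so they are taken real-valued. -/
structure SmoothStronglyConvex (μ L : ℝ) (f : H → ℝ) : Prop where
  strongConvex : StrongConvexOn univ μ f
  differentiable : Differentiable ℝ f
  lipschitz_gradient : ∀ x y : H, ‖gradient f x - gradient f y‖ ≤ L * ‖x - y‖

/-- The class of convex, proper, lower semicontinuous functions `H → ℝ ∪ {+∞}`. -/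
structure ConvexProperLsc (g : H → EReal) : Prop where
  ne_bot : ∀ x, g x ≠ ⊥
  proper : ∃ x, g x ≠ ⊤
  convex : ∀ x y : H, ∀ t : ℝ, 0 ≤ t → t ≤ 1 →
    g ((1 - t) • x + t • y) ≤ ((1 - t : ℝ) : EReal) * g x + (t : EReal) * g y
  lsc : LowerSemicontinuous g

/-- `u` is a minimizer of `f + g` over `H`. -/
def IsSolution (f : H → ℝ) (g : H → EReal) (u : H) : Prop :=
  IsMinOn (fun w => (f w : EReal) + g w) univ u

/-- `p` minimizes `z ↦ g z + ‖x - z‖² / (2γ)` over `H`. -/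
def IsProx (g : H → EReal) (γ : ℝ) (x p : H) : Prop :=
  IsMinOn (fun z => g z + ((1 / (2 * γ) * ‖x - z‖ ^ 2 : ℝ) : EReal)) univ p

/-- The proximal operator of `g` with parameter `γ`. For `g` convex, proper and lower
semicontinuous and `γ > 0` the minimizer exists and is unique. -/
def prox (g : H → EReal) (γ : ℝ) (x : H) : H :=
  Classical.epsilon (IsProx g γ x)

/-- `u` is a possible output of the span rule with exactly `k` gradient calls to `f` and any number
of proximal calls to `g`, started at `u₀`. There are `m` calls in total; call `ℓ` is made at `v ℓ`
and answers `s ℓ`; it is a gradient call if `θ ℓ = true` and a proximal call with parameter `γ ℓ`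
otherwise. The queries `v ℓ` and the output `u` lie in `u₀` plus the span of the earlier
answers. -/
def SpanReachable (k : ℕ) (f : H → ℝ) (g : H → EReal) (u₀ u : H) : Prop :=
  ∃ (m : ℕ) (θ : ℕ → Bool) (γ : ℕ → ℝ) (v s : ℕ → H),
    k ≤ m ∧
    ((Finset.range m).filter (fun ℓ => θ ℓ = true)).card = k ∧
    v 0 = u₀ ∧
    (∀ ℓ < m, θ ℓ = true → s ℓ = gradient f (v ℓ)) ∧
    (∀ ℓ < m, θ ℓ = false → 0 < γ ℓ ∧ s ℓ = (γ ℓ)⁻¹ • (v ℓ - prox g (γ ℓ) (v ℓ))) ∧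
    (∀ ℓ < m, 1 ≤ ℓ → v ℓ - u₀ ∈ Submodule.span ℝ (s '' {i | i < ℓ})) ∧
    u - u₀ ∈ Submodule.span ℝ (s '' {i | i < m})

end Classes

/-- A method assigns an output point to each Hilbert space, pair of functions and initial point. -/
abbrev Method : Type (u + 1) :=
  ∀ (H : Type u) [NormedAddCommGroup H] [InnerProductSpace ℝ H] [CompleteSpace H],
    (H → ℝ) → (H → EReal) → H → H

/-- The class of span-based methods with `k` gradient calls and any number of proximal calls. -/
def spanMethods (k : ℕ) (μ L : ℝ) : Set Method.{u} :=
  {A | ∀ (H : Type u) [NormedAddCommGroup H] [InnerProductSpace ℝ H] [CompleteSpace H]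
    (f : H → ℝ) (g : H → EReal) (u₀ : H),
    SmoothStronglyConvex μ L f → ConvexProperLsc g → SpanReachable k f g u₀ (A H f g u₀)}

/-- The worst-case relative squared distance to the solution, as an element of `[0, ∞]`. -/
def risk (μ L : ℝ) (A : Method.{u}) : ENNReal :=
  sSup {r | ∃ (H : Type u) (_ : NormedAddCommGroup H) (_ : InnerProductSpace ℝ H)
    (_ : CompleteSpace H) (f : H → ℝ) (g : H → EReal) (us u₀ : H),
    SmoothStronglyConvex μ L f ∧ ConvexProperLsc g ∧ IsSolution f g us ∧ u₀ ≠ us ∧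
    r = ENNReal.ofReal (‖A H f g u₀ - us‖ ^ 2 / ‖u₀ - us‖ ^ 2)}

/-- The scalar sequence `A_k`. -/
def seqA (q : ℝ) : ℕ → ℝ
  | 0 => 0
  | k + 1 => ((1 + q) * seqA q k + 2 * (1 + √((1 + seqA q k) * (1 + q * seqA q k)))) / (1 - q) ^ 2

/-- The coefficient `β_k`. -/
def seqBeta (q : ℝ) (k : ℕ) : ℝ := seqA q k / ((1 - q) * seqA q (k + 1))

/-- The coefficient `δ_k`. -/
def seqDelta (q : ℝ) (k : ℕ) : ℝ := √(seqA q (k + 1) / (1 + q * seqA q (k + 1)))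

/-- The pair of iterates `(x^k, z^k)` of Prox-ITEM with `x^0 = z^0 = u₀`. -/
def proxItemIter {H : Type u} [NormedAddCommGroup H] [InnerProductSpace ℝ H] [CompleteSpace H]
    (μ L : ℝ) (f : H → ℝ) (g : H → EReal) (u₀ : H) : ℕ → H × H
  | 0 => (u₀, u₀)
  | k + 1 =>
    let q : ℝ := μ / L
    let β : ℝ := seqBeta q k
    let δ : ℝ := seqDelta q k
    let x : H := (proxItemIter μ L f g u₀ k).1
    let z : H := (proxItemIter μ L f g u₀ k).2
    let y : H := (1 - β) • z + β • x
    let zbar : H := (1 - q * δ) • z + (q * δ) • y - (δ / L) • gradient f y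
    let znext : H := prox g (δ / L) zbar
    let xnext : H := y - (1 / L) • gradient f y - (1 / δ) • (zbar - znext)
    (xnext, znext)

/-- Prox-ITEM run for `k` iterations from `x^0 = u₀`, with output `z^k`. -/
def proxItem (μ L : ℝ) (k : ℕ) : Method.{u} :=
  fun _ _ _ _ f g u₀ => (proxItemIter μ L f g u₀ k).2

end

end ProxItem

/-!
The value `1 / (1 + q A_k)`, with `q = μ / L`, is a guarantee for Prox-ITEM and a lower bound for
every span-based method.

*Upper bound.* Recentre `f` and `g` at the solution `us` by the affine function with slope
`∇f(us)`, and subtract `μ/2 ‖· - us‖²` from `f`; then both terms are convex and minimal at `us`, the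
first with cocoercive gradient. Prox-ITEM does not increase the quantity `potential`, which is
`(1 + q A_k) ‖z^k - us‖²` plus nonnegative terms: the interpolation slack of `f` at the last
gradient call, a gap `⟪h, z^k - us⟫ - g(z^k)` and a multiple of `‖h‖²`, where `h` is the subgradient
of `g` delivered by the last proximal call. The decrease `potential_step` is an exact identity with
nonnegative multiples of the available inequalities; it rests on the two relations `seqDelta_sq` and
`two_mul_seqDelta`. Proximal points exist because the solution provides an affine minorant of `g`
(`exists_isProx`).

*Lower bound.* One instance in dimension `k + 1` resists all methods. There `g = 0`, so proximal
calls are useless, and `f = μ/2 ‖·‖²` plus the Moreau envelope, with parameter `1 / (L - μ)`, of a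
maximum of affine functions with slopes `a_0, …, a_k`,
`a_j = -c_j e_j - ∑ m < j, G_m e_m`. Through the dual problem over the simplex, the envelope
satisfies the interpolation inequality (`smoothMax_interpolation`). The offsets are such that the
gradient at a point with vanishing coordinates from `i` on has vanishing coordinates from `i + 1` on
(`smoothMaxGradient_mem_chainSubspace`). Hence after `k` gradient calls from the origin the last
coordinate is still zero, while the minimizer is `-a_k / μ`, proportional to `(G_0, …, G_k)`. This
gives the bound `G_k² / ∑ G_m²`. The choice `G_i / c_i = q δ_i` for `i < k` and `G_k = c_k` turns it
into `1 / (1 + q A_k)` (`sum_chainWeight`).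
-/

namespace ProxItem

/-! ### The scalar sequences -/

section Scalars

variable {q : ℝ}

lemma seqA_nonneg (hq0 : 0 < q) (k : ℕ) : 0 ≤ seqA q k := by
  induction k with
  | zero => simp [seqA]
  | succ k ih =>
    simp only [seqA]
    positivity

/-- Consecutive terms of the sequence solve a quadratic equation that is symmetric in them up to
the linear term; it is the source of every relation between `A_k`, `A_{k+1}` and `δ_k`. -/
lemma seqA_quadratic (hq0 : 0 < q) (hq1 : q < 1) (k : ℕ) :
    ((1 + q) * seqA q (k + 1) - seqA q k) ^ 2 =
      4 * seqA q (k + 1) * (1 + q * seqA q (k + 1)) := by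
  have hA := seqA_nonneg hq0 k
  have h1 : (1 - q) ≠ 0 := by linarith
  set A := seqA q k with hAdef
  have hD : √((1 + A) * (1 + q * A)) ^ 2 = (1 + A) * (1 + q * A) :=
    Real.sq_sqrt (by positivity)
  set D := √((1 + A) * (1 + q * A)) with hDdef
  have hA' : seqA q (k + 1) = ((1 + q) * A + 2 * (1 + D)) / (1 - q) ^ 2 := by
    simp only [seqA]; rfl
  rw [hA']
  field_simp
  linear_combination (4 * (1 - q) ^ 2) * hD

lemma one_lt_seqA_succ (hq0 : 0 < q) (hq1 : q < 1) (k : ℕ) :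
    1 < (1 - q) * seqA q (k + 1) := by
  have hA := seqA_nonneg hq0 k
  have hD := Real.sqrt_nonneg ((1 + seqA q k) * (1 + q * seqA q k))
  have h1 : 0 < 1 - q := by linarith
  have : (1 - q) * seqA q (k + 1) = ((1 + q) * seqA q k +
      2 * (1 + √((1 + seqA q k) * (1 + q * seqA q k)))) / (1 - q) := by
    simp only [seqA]; field_simp
  rw [this, lt_div_iff₀ h1]
  nlinarith [mul_nonneg hq0.le hA]

lemma seqA_le_succ (hq0 : 0 < q) (hq1 : q < 1) (k : ℕ) : seqA q k ≤ seqA q (k + 1) := by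
  have hA := seqA_nonneg hq0 k
  have hD := Real.sqrt_nonneg ((1 + seqA q k) * (1 + q * seqA q k))
  have h1 : 0 < 1 - q := by linarith
  rw [show seqA q (k + 1) = ((1 + q) * seqA q k +
      2 * (1 + √((1 + seqA q k) * (1 + q * seqA q k)))) / (1 - q) ^ 2 from rfl,
    le_div_iff₀ (by positivity)]
  nlinarith [mul_nonneg hq0.le hA, mul_nonneg (mul_nonneg hq0.le hA) h1.le]

lemma seqDelta_sq (hq0 : 0 < q) (k : ℕ) :
    seqDelta q k ^ 2 * (1 + q * seqA q (k + 1)) = seqA q (k + 1) := by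
  have hA := seqA_nonneg hq0 (k + 1)
  rw [seqDelta, Real.sq_sqrt (by positivity)]
  field_simp

lemma two_mul_seqDelta (hq0 : 0 < q) (hq1 : q < 1) (k : ℕ) :
    2 * (1 + q * seqA q (k + 1)) * seqDelta q k = (1 + q) * seqA q (k + 1) - seqA q k := by
  have hA := seqA_nonneg hq0 (k + 1)
  have hd : 0 ≤ seqDelta q k := Real.sqrt_nonneg _
  have hle := seqA_le_succ hq0 hq1 k
  refine (sq_eq_sq₀ (by positivity) (by nlinarith)).1 ?_
  rw [seqA_quadratic hq0 hq1]
  linear_combination (4 * (1 + q * seqA q (k + 1))) * seqDelta_sq hq0 k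

lemma one_lt_seqDelta (hq0 : 0 < q) (hq1 : q < 1) (k : ℕ) : 1 < seqDelta q k := by
  have hA := seqA_nonneg hq0 (k + 1)
  have h := one_lt_seqA_succ hq0 hq1 k
  rw [seqDelta, Real.lt_sqrt zero_le_one, lt_div_iff₀ (by positivity)]
  linarith

lemma mul_seqDelta_lt_one (hq0 : 0 < q) (hq1 : q < 1) (k : ℕ) : q * seqDelta q k < 1 := by
  have hA := seqA_nonneg hq0 (k + 1)
  have h1 := one_lt_seqDelta hq0 hq1 k
  have h2 := seqDelta_sq hq0 k
  by_contra! h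
  have h3 : 1 ≤ (q * seqDelta q k) ^ 2 := by nlinarith
  have h4 : q * (q * seqA q (k + 1)) ≤ 1 * (q * seqA q (k + 1)) :=
    mul_le_mul_of_nonneg_right hq1.le (by positivity)
  nlinarith

end Scalars

/-! ### The potential function -/

section Potential

variable {E : Type*} [NormedAddCommGroup E] [InnerProductSpace ℝ E]

/-- The potential that Prox-ITEM does not increase, in coordinates centred at the solution: `z` is
the current iterate, `h` a subgradient at `z` of the recentred nonsmooth term, whose value there is
`g`, and `e` is the interpolation slack of the recentred smooth term at the previous gradient
call. -/
noncomputable def potential (q L A : ℝ) (z h : E) (e g : ℝ) : ℝ :=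
  (1 + q * A) * ‖z‖ ^ 2 + (1 - q) * A / L * e + q * A / L * (inner ℝ h z - g) +
    A / (2 * L ^ 2) * ‖h‖ ^ 2

/-- One step of Prox-ITEM does not increase the potential. The hypotheses on previous data carry
the factor `A`, so that nothing is required of them at the first step, where `A = 0`. -/
lemma potential_step {q L δ A A' : ℝ} (hL : 0 < L) (hq0 : 0 < q) (hq1 : q < 1) (hδ : 1 < δ)
    (hqδ : q * δ < 1) (hA : 0 ≤ A) (hAA' : A ≤ A') (hA' : 0 < A')
    (hδ2 : δ ^ 2 * (1 + q * A') = A')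
    (hδ1 : 2 * (1 + q * A') * δ = (1 + q) * A' - A)
    {z x y xt p h h' z' : E} {e e' g g' : ℝ}
    (hx : x = (1 - q) • xt - (1 / L) • h)
    (hy : y = (1 - A / ((1 - q) * A')) • z + (A / ((1 - q) * A')) • x)
    (hz' : z' = (1 - q * δ) • z - (δ / L) • (p + h'))
    (he1 : e' ≤ inner ℝ p y - ‖p‖ ^ 2 / ((1 - q) * L))
    (he2 : A * e' ≤ A * (e + inner ℝ p (y - xt) - ‖p‖ ^ 2 / ((1 - q) * L)))
    (hg1 : A * inner ℝ h (z' - z) ≤ A * (g' - g))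
    (hg2 : g' ≤ inner ℝ h' z') (hg' : 0 ≤ g') (hg : 0 ≤ g) :
    potential q L A' z' h' e' g' ≤ potential q L A z h e g := by
  obtain ⟨B, hBdef⟩ : ∃ B, B = 1 + q * A' := ⟨_, rfl⟩
  have hB : 0 < B := by rw [hBdef]; positivity
  rw [← hBdef] at hδ2 hδ1
  -- everything is expressed through `δ` and `B`, subject to the single relation `h1`
  have hA'eq : A' = δ ^ 2 * B := hδ2.symm
  have hAeq : A = ((1 + q) * δ ^ 2 - 2 * δ) * B := by rw [hA'eq] at hδ1; linarith
  have h1 : B * (1 - q * δ ^ 2) = 1 := by rw [hA'eq] at hBdef; linarith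
  have h1q : 0 < 1 - q := by linarith
  have hδ0 : 0 < δ := by linarith
  have hBA' : 1 + q * A' = B := hBdef.symm
  have hBA : 1 + q * A = B * (1 - q * δ) ^ 2 := by rw [hAeq]; linear_combination -h1
  have hβ : A / ((1 - q) * A') = ((1 + q) * δ - 2) / ((1 - q) * δ) := by
    rw [hAeq, hA'eq]; field_simp
  have s1 := mul_nonneg (div_pos h1q hL).le (sub_nonneg.2 he2)
  have s2 := mul_nonneg (mul_nonneg (div_pos h1q hL).le (sub_nonneg.2 hAA')) (sub_nonneg.2 he1)
  have s3 := mul_nonneg (one_div_pos.2 (mul_pos hL hδ0)).le (sub_nonneg.2 hg1)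
  have s4 := mul_nonneg (div_nonneg (sub_nonneg.2 hAA') hL.le) (sub_nonneg.2 hg2)
  have s5 := mul_nonneg (div_nonneg hA (by positivity : 0 ≤ 2 * L ^ 2)) (sq_nonneg ‖h - h'‖)
  have s6 := mul_nonneg (div_nonneg (sub_nonneg.2 hAA') (by positivity : 0 ≤ 2 * L ^ 2))
    (sq_nonneg ‖h'‖)
  have s7 := mul_nonneg (div_nonneg (mul_nonneg hA (sub_nonneg.2 hqδ.le)) (mul_pos hL hδ0).le) hg
  have s8 := mul_nonneg (div_nonneg (by linarith : 0 ≤ 2 * A' - A) (mul_pos hL hδ0).le) hg'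
  -- the decrease is an explicit nonnegative combination of the hypotheses and two squares
  have key : potential q L A z h e g - potential q L A' z' h' e' g' =
      (1 - q) / L * (A * (e + inner ℝ p (y - xt) - ‖p‖ ^ 2 / ((1 - q) * L)) - A * e') +
      (1 - q) / L * (A' - A) * (inner ℝ p y - ‖p‖ ^ 2 / ((1 - q) * L) - e') +
      1 / (L * δ) * (A * (g' - g) - A * inner ℝ h (z' - z)) +
      (A' - A) / L * (inner ℝ h' z' - g') +
      A / (2 * L ^ 2) * ‖h - h'‖ ^ 2 + (A' - A) / (2 * L ^ 2) * ‖h'‖ ^ 2 +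
      A * (1 - q * δ) / (L * δ) * g + (2 * A' - A) / (L * δ) * g' := by
    have hy' : y = (1 - ((1 + q) * δ - 2) / ((1 - q) * δ)) • z +
        (((1 + q) * δ - 2) / ((1 - q) * δ)) • ((1 - q) • xt - (1 / L) • h) := by
      rw [hy, hβ, hx]
    unfold potential
    rw [hBA', hBA, hy', hz']
    simp only [← real_inner_self_eq_norm_sq, inner_add_left, inner_add_right, inner_sub_left,
      inner_sub_right, real_inner_smul_left, real_inner_smul_right]
    rw [real_inner_comm z p, real_inner_comm z h, real_inner_comm z h', real_inner_comm p h,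
      real_inner_comm p h', real_inner_comm h h', hAeq, hA'eq]
    field_simp
    ring
  linarith

end Potential

/-! ### First-order inequalities -/

section FirstOrder

open Filter Topology

variable {H : Type u} [NormedAddCommGroup H] [InnerProductSpace ℝ H] [CompleteSpace H]
  {μ L : ℝ} {f : H → ℝ} {g : H → EReal}

lemma hasDerivAt_comp_line {v u d : H} {t : ℝ} (hf : HasGradientAt f v (u + t • d)) :
    HasDerivAt (fun s : ℝ => f (u + s • d)) (inner ℝ v d) t := by
  have h1 : HasDerivAt (fun s : ℝ => u + s • d) d t := by
    simpa using ((hasDerivAt_id t).smul_const d).const_add u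
  have h2 := hf.hasFDerivAt.comp_hasDerivAt t h1
  simpa [Function.comp_def] using h2

/-- A lower bound `a` on the difference quotients along `d`, up to an error of first order in the
step, bounds the directional derivative. -/
lemma le_inner_gradient {v u d : H} {a b : ℝ} (hf : HasGradientAt f v u)
    (h : ∀ t ∈ Ioo (0 : ℝ) 1, t * (a - t * b) ≤ f (u + t • d) - f u) : a ≤ inner ℝ v d := by
  have hd : HasDerivAt (fun s : ℝ => f (u + s • d)) (inner ℝ v d) 0 :=
    hasDerivAt_comp_line (by simpa using hf)
  have h1 : Tendsto (slope (fun s : ℝ => f (u + s • d)) 0) (𝓝[>] 0) (𝓝 (inner ℝ v d)) :=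
    (hasDerivAt_iff_tendsto_slope.1 hd).mono_left
      (nhdsWithin_mono _ fun t (ht : 0 < t) => ht.ne')
  have h2 : Tendsto (fun t : ℝ => a - t * b) (𝓝[>] 0) (𝓝 a) := by
    have : Continuous fun t : ℝ => a - t * b := by fun_prop
    simpa using (this.tendsto 0).mono_left nhdsWithin_le_nhds
  refine le_of_tendsto_of_tendsto h2 h1 ?_
  filter_upwards [Ioo_mem_nhdsGT (zero_lt_one' ℝ)] with t ht
  have := h t ht
  rw [slope_def_field, le_div_iff₀ (by linarith [ht.1])]
  simp only [zero_smul, add_zero, sub_zero]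
  linarith

namespace SmoothStronglyConvex

lemma hasGradientAt (hf : SmoothStronglyConvex μ L f) (x : H) :
    HasGradientAt f (gradient f x) x :=
  (hf.differentiable x).hasGradientAt

lemma lower_bound (hf : SmoothStronglyConvex μ L f) (x y : H) :
    f x + inner ℝ (gradient f x) (y - x) + μ / 2 * ‖y - x‖ ^ 2 ≤ f y := by
  have key : f x - f y + μ / 2 * ‖y - x‖ ^ 2 ≤ inner ℝ (-gradient f x) (y - x) := by
    have hneg : HasGradientAt (fun z => -f z) (-gradient f x) x := by
      have := (hf.hasGradientAt x).hasFDerivAt.neg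
      rw [hasGradientAt_iff_hasFDerivAt, map_neg]
      exact this
    refine le_inner_gradient (b := μ / 2 * ‖y - x‖ ^ 2) hneg fun t ht => ?_
    have h := hf.strongConvex.2 (mem_univ x) (mem_univ y) (by linarith [ht.2] : 0 ≤ 1 - t)
      ht.1.le (by ring)
    rw [show (1 - t) • x + t • y = x + t • (y - x) by module, norm_sub_rev x y] at h
    simp only [smul_eq_mul] at h
    nlinarith
  rw [inner_neg_left] at key
  linarith

/-- The descent lemma. -/
lemma upper_bound (hf : SmoothStronglyConvex μ L f) (x y : H) :
    f y ≤ f x + inner ℝ (gradient f x) (y - x) + L / 2 * ‖y - x‖ ^ 2 := by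
  set d := y - x with hd
  let ψ : ℝ → ℝ := fun t =>
    f (x + t • d) - (t * inner ℝ (gradient f x) d + L / 2 * ‖d‖ ^ 2 * t ^ 2)
  have hψ : ∀ t, HasDerivAt ψ (inner ℝ (gradient f (x + t • d)) d -
      (inner ℝ (gradient f x) d + L / 2 * ‖d‖ ^ 2 * (2 * t))) t := by
    intro t
    have h1 := hasDerivAt_comp_line (hf.hasGradientAt (x + t • d))
    have h2 : HasDerivAt (fun s : ℝ => s * inner ℝ (gradient f x) d)
        (inner ℝ (gradient f x) d) t := by
      simpa using (hasDerivAt_id t).mul_const (inner ℝ (gradient f x) d)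
    have h3 : HasDerivAt (fun s : ℝ => L / 2 * ‖d‖ ^ 2 * s ^ 2) (L / 2 * ‖d‖ ^ 2 * (2 * t)) t := by
      simpa using (hasDerivAt_pow 2 t).const_mul (L / 2 * ‖d‖ ^ 2)
    exact h1.sub (h2.add h3)
  have hanti : AntitoneOn ψ (Icc 0 1) := by
    refine antitoneOn_of_deriv_nonpos (convex_Icc 0 1)
      (fun t _ => (hψ t).continuousAt.continuousWithinAt)
      (fun t _ => (hψ t).differentiableAt.differentiableWithinAt) fun t ht => ?_
    rw [interior_Icc] at ht
    rw [(hψ t).deriv]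
    have h1 : inner ℝ (gradient f (x + t • d) - gradient f x) d ≤ L * ‖t • d‖ * ‖d‖ :=
      (real_inner_le_norm _ _).trans (mul_le_mul_of_nonneg_right
        (by simpa using hf.lipschitz_gradient (x + t • d) x) (norm_nonneg _))
    rw [inner_sub_left, norm_smul, Real.norm_of_nonneg ht.1.le] at h1
    nlinarith
  have h := hanti (left_mem_Icc.2 zero_le_one) (right_mem_Icc.2 zero_le_one) zero_le_one
  simp only [ψ, zero_smul, add_zero, one_smul] at h
  rw [show x + d = y by rw [hd]; abel] at h
  linarith

/-- The interpolation inequality of the class: cocoercivity of the gradient of the smooth convex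
function `f - μ/2 ‖·‖²`. -/
lemma interpolation (hf : SmoothStronglyConvex μ L f) (hμL : μ < L) (x y : H) :
    f y + inner ℝ (gradient f y) (x - y) + μ / 2 * ‖x - y‖ ^ 2 +
      1 / (2 * (L - μ)) * ‖gradient f x - gradient f y - μ • (x - y)‖ ^ 2 ≤ f x := by
  have hl : 0 < L - μ := sub_pos.2 hμL
  set r := gradient f x - gradient f y - μ • (x - y) with hr
  -- compare the two quadratic bounds at a gradient step of length `1 / (L - μ)`
  have h1 := hf.lower_bound y (x - (1 / (L - μ)) • r)
  have h2 := hf.upper_bound x (x - (1 / (L - μ)) • r)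
  rw [show x - (1 / (L - μ)) • r - y = (x - y) - (1 / (L - μ)) • r by abel] at h1
  rw [show x - (1 / (L - μ)) • r - x = -((1 / (L - μ)) • r) by abel] at h2
  have hrr : ‖r‖ ^ 2 = inner ℝ (gradient f x) r - inner ℝ (gradient f y) r -
      μ * inner ℝ (x - y) r := by
    rw [← real_inner_self_eq_norm_sq]
    nth_rw 1 [hr]
    rw [inner_sub_left, inner_sub_left, real_inner_smul_left]
  rw [norm_sub_sq_real, inner_sub_right, real_inner_smul_right, real_inner_smul_right,
    norm_smul, mul_pow, Real.norm_eq_abs, sq_abs] at h1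
  rw [inner_neg_right, norm_neg, real_inner_smul_right, norm_smul, mul_pow, Real.norm_eq_abs,
    sq_abs] at h2
  have h3 : 1 / (L - μ) * inner ℝ (gradient f x) r - 1 / (L - μ) * inner ℝ (gradient f y) r -
      μ * (1 / (L - μ) * inner ℝ (x - y) r) - (L - μ) / 2 * ((1 / (L - μ)) ^ 2 * ‖r‖ ^ 2) =
      1 / (2 * (L - μ)) * ‖r‖ ^ 2 := by
    have : inner ℝ (gradient f x) r = ‖r‖ ^ 2 + inner ℝ (gradient f y) r +
      μ * inner ℝ (x - y) r := by linarith
    rw [this]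
    field_simp
    ring
  linarith

end SmoothStronglyConvex

/-! ### Minimizers of composite functions and the proximal operator -/

/-- At a minimizer of `φ + g` with `φ` differentiable, `g` is finite and `-∇φ` is a subgradient of
`g`. -/
lemma ConvexProperLsc.subgradient_of_isMinOn (hg : ConvexProperLsc g) {φ : H → ℝ} {v u : H}
    (hφ : HasGradientAt φ v u) (hmin : IsMinOn (fun w => (φ w : EReal) + g w) univ u) :
    ∃ gu : ℝ, g u = gu ∧ ∀ (w : H) (r : ℝ), g w = r → gu - inner ℝ v (w - u) ≤ r := by
  obtain ⟨x₀, hx₀⟩ := hg.proper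
  have hu : g u ≠ ⊤ := by
    intro htop
    have h := hmin (mem_univ x₀)
    simp only [mem_ofPred_eq, htop, EReal.coe_add_top, top_le_iff] at h
    lift g x₀ to ℝ using ⟨hx₀, hg.ne_bot x₀⟩ with r₀
    exact EReal.coe_ne_top _ (by rw [← EReal.coe_add] at h; exact h)
  refine ⟨(g u).toReal, (EReal.coe_toReal hu (hg.ne_bot u)).symm, fun w r hw => ?_⟩
  have hgu : g u = ((g u).toReal : EReal) := (EReal.coe_toReal hu (hg.ne_bot u)).symm
  set gu := (g u).toReal
  have key : gu - r ≤ inner ℝ v (w - u) := by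
    refine le_inner_gradient (b := 0) hφ fun t ht => ?_
    have h1 := hg.convex u w t ht.1.le ht.2.le
    have h2 := hmin (mem_univ ((1 - t) • u + t • w))
    simp only [mem_ofPred_eq] at h2
    have h3 := h2.trans (add_le_add_right h1 _)
    rw [hgu, hw, show (1 - t) • u + t • w = u + t • (w - u) by module] at h3
    norm_cast at h3
    linarith
  linarith

lemma hasGradientAt_sq_dist (c : ℝ) (x p : H) :
    HasGradientAt (fun z => c * ‖x - z‖ ^ 2) ((2 * c) • (p - x)) p := by
  have h1 : HasFDerivAt (fun z : H => x - z) (-ContinuousLinearMap.id ℝ H) p := by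
    simpa using (hasFDerivAt_id p).const_sub x
  have h2 := (h1.norm_sq).const_mul c
  rw [hasGradientAt_iff_hasFDerivAt]
  refine h2.congr_fderiv ?_
  ext w
  simp
  ring

lemma IsProx.subgradient (hg : ConvexProperLsc g) {γ : ℝ} (hγ : 0 < γ) {x p : H}
    (hp : IsProx g γ x p) :
    ∃ gp : ℝ, g p = gp ∧
      ∀ (w : H) (r : ℝ), g w = r → gp + inner ℝ ((1 / γ) • (x - p)) (w - p) ≤ r := by
  obtain ⟨gp, h1, h2⟩ := hg.subgradient_of_isMinOn (hasGradientAt_sq_dist (1 / (2 * γ)) x p)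
    (by simpa only [IsProx, add_comm] using hp)
  refine ⟨gp, h1, fun w r hw => ?_⟩
  have := h2 w r hw
  rw [show (2 * (1 / (2 * γ))) • (p - x) = -((1 / γ) • (x - p)) by
    rw [← smul_neg, neg_sub]; congr 1; field_simp, inner_neg_left] at this
  linarith

/-- The proximal operator is well defined for `g` with an affine minorant: by strong convexity of
the proximal objective, a minimizing sequence is a Cauchy sequence. -/
lemma exists_isProx (hg : ConvexProperLsc g) {γ : ℝ} (hγ : 0 < γ) (x : H) {a : ℝ} {v u : H}
    (hmin : ∀ (w : H) (r : ℝ), g w = r → a - inner ℝ v (w - u) ≤ r) : ∃ p, IsProx g γ x p := by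
  have hc : 0 < 1 / (2 * γ) := by positivity
  obtain ⟨c, hcdef⟩ : ∃ c, c = 1 / (2 * γ) := ⟨_, rfl⟩
  rw [← hcdef] at hc
  let S : Set ℝ := {s | ∃ (w : H) (r : ℝ), g w = (r : EReal) ∧ s = r + c * ‖x - w‖ ^ 2}
  have hSne : S.Nonempty := by
    obtain ⟨x₀, hx₀⟩ := hg.proper
    exact ⟨_, x₀, (g x₀).toReal, (EReal.coe_toReal hx₀ (hg.ne_bot x₀)).symm, rfl⟩
  have hSbdd : BddBelow S := by
    refine ⟨a - inner ℝ v (x - u) - ‖v‖ ^ 2 / (4 * c), ?_⟩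
    rintro s ⟨w, r, hw, rfl⟩
    have h1 := hmin w r hw
    have h2 : inner ℝ v (w - u) = inner ℝ v (x - u) - inner ℝ v (x - w) := by
      rw [← inner_sub_right]; congr 1; abel
    have h3 : -(‖v‖ * ‖x - w‖) ≤ inner ℝ v (x - w) := by
      have := abs_real_inner_le_norm v (x - w)
      exact (abs_le.1 this).1
    have h4 : ‖v‖ * ‖x - w‖ ≤ ‖v‖ ^ 2 / (4 * c) + c * ‖x - w‖ ^ 2 := by
      have : 0 ≤ (‖v‖ - 2 * c * ‖x - w‖) ^ 2 / (4 * c) := by positivity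
      have h5 : (‖v‖ - 2 * c * ‖x - w‖) ^ 2 / (4 * c) =
          ‖v‖ ^ 2 / (4 * c) + c * ‖x - w‖ ^ 2 - ‖v‖ * ‖x - w‖ := by
        field_simp; ring
      linarith
    linarith
  set m := sInf S with hm
  have hmle : ∀ (w : H) (r : ℝ), g w = (r : EReal) → m ≤ r + c * ‖x - w‖ ^ 2 := fun w r hw =>
    csInf_le hSbdd ⟨w, r, hw, rfl⟩
  have hseq : ∀ n : ℕ, ∃ (w : H) (r : ℝ), g w = (r : EReal) ∧
      r + c * ‖x - w‖ ^ 2 < m + 1 / (n + 1) := by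
    intro n
    obtain ⟨s, ⟨w, r, hw, rfl⟩, hs⟩ := exists_lt_of_csInf_lt hSne
      (lt_add_of_pos_right m (by positivity : (0 : ℝ) < 1 / (n + 1)))
    exact ⟨w, r, hw, hs⟩
  choose w r hw hwr using hseq
  have hdist : ∀ i j N : ℕ, N ≤ i → N ≤ j → ‖w i - w j‖ ^ 2 ≤ 4 / c * (1 / (N + 1)) := by
    intro i j N hi hj
    have hi' : (1 : ℝ) / (i + 1) ≤ 1 / (N + 1) := by gcongr
    have hj' : (1 : ℝ) / (j + 1) ≤ 1 / (N + 1) := by gcongr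
    have h1 := hg.convex (w i) (w j) (1 / 2) (by norm_num) (by norm_num)
    rw [hw, hw] at h1
    have h2 : g ((1 - 1 / 2 : ℝ) • w i + (1 / 2 : ℝ) • w j) ≠ ⊤ := by
      intro h
      rw [h, top_le_iff] at h1
      norm_cast at h1
      exact EReal.coe_ne_top _ h1
    lift g ((1 - 1 / 2 : ℝ) • w i + (1 / 2 : ℝ) • w j) to ℝ using ⟨h2, hg.ne_bot _⟩ with s hs
    norm_cast at h1
    have h3 := hmle _ s hs.symm
    have h4 : ‖x - ((1 - 1 / 2 : ℝ) • w i + (1 / 2 : ℝ) • w j)‖ ^ 2 =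
        1 / 2 * ‖x - w i‖ ^ 2 + 1 / 2 * ‖x - w j‖ ^ 2 - 1 / 4 * ‖w i - w j‖ ^ 2 := by
      rw [show x - ((1 - 1 / 2 : ℝ) • w i + (1 / 2 : ℝ) • w j) =
        (1 / 2 : ℝ) • ((x - w i) + (x - w j)) by module,
        show w i - w j = (x - w j) - (x - w i) by abel]
      generalize x - w i = a₁
      generalize x - w j = a₂
      rw [norm_smul, mul_pow, norm_add_sq_real, norm_sub_sq_real, real_inner_comm a₁ a₂]
      norm_num
      ring
    rw [h4] at h3
    have h5 := hwr i
    have h6 := hwr j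
    have h7 : c * ‖w i - w j‖ ^ 2 ≤ 4 * (1 / (N + 1)) := by
      nlinarith
    calc ‖w i - w j‖ ^ 2 = (c * ‖w i - w j‖ ^ 2) / c := by field_simp
      _ ≤ 4 * (1 / (N + 1)) / c := by gcongr
      _ = 4 / c * (1 / (N + 1)) := by ring
  have hcauchy : CauchySeq w := by
    refine cauchySeq_of_le_tendsto_0 (fun N : ℕ => √(4 / c * (1 / ((N : ℝ) + 1)))) ?_ ?_
    · intro i j N hi hj
      rw [dist_eq_norm]
      exact Real.le_sqrt_of_sq_le (hdist i j N hi hj)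
    · have h1 : Tendsto (fun N : ℕ => 4 / c * (1 / ((N : ℝ) + 1))) atTop (𝓝 (4 / c * 0)) :=
        tendsto_one_div_add_atTop_nhds_zero_nat.const_mul _
      simpa [Function.comp_def] using (Real.continuous_sqrt.tendsto _).comp h1
  obtain ⟨p, hp⟩ := cauchySeq_tendsto_of_complete hcauchy
  refine ⟨p, fun y _ => ?_⟩
  simp only [mem_ofPred_eq, ← hcdef]
  have hlsc : LowerSemicontinuous fun z => g z + ((c * ‖x - z‖ ^ 2 : ℝ) : EReal) := by
    refine hg.lsc.add' (Continuous.lowerSemicontinuous ?_) fun z => ?_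
    · exact continuous_coe_real_ereal.comp (by fun_prop)
    · exact EReal.continuousAt_add (Or.inr (EReal.coe_ne_bot _)) (Or.inr (EReal.coe_ne_top _))
  have hle : ∀ n : ℕ, g p + ((c * ‖x - p‖ ^ 2 : ℝ) : EReal) ≤ ((m + 1 / (n + 1) : ℝ) : EReal) := by
    intro n
    refine (hlsc.isClosed_preimage ((m + 1 / (n + 1) : ℝ) : EReal)).mem_of_tendsto hp ?_
    filter_upwards [eventually_ge_atTop n] with i hi
    have hi' : (1 : ℝ) / (i + 1) ≤ 1 / (n + 1) := by gcongr
    rw [mem_preimage, mem_Iic, hw i, ← EReal.coe_add, EReal.coe_le_coe_iff]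
    linarith [hwr i]
  have hlim : g p + ((c * ‖x - p‖ ^ 2 : ℝ) : EReal) ≤ (m : EReal) := by
    have h1 : Tendsto (fun n : ℕ => m + 1 / ((n : ℝ) + 1)) atTop (𝓝 m) := by
      simpa using (tendsto_one_div_add_atTop_nhds_zero_nat (𝕜 := ℝ)).const_add m
    exact ge_of_tendsto' ((continuous_coe_real_ereal.tendsto m).comp h1) hle
  refine hlim.trans ?_
  by_cases hy : g y = ⊤
  · rw [hy, EReal.top_add_coe]
    exact le_top
  · lift g y to ℝ using ⟨hy, hg.ne_bot y⟩ with s hs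
    exact_mod_cast hmle y s hs.symm

end FirstOrder

/-! ### Convergence of Prox-ITEM -/

section UpperBound

variable {H : Type u} [NormedAddCommGroup H] [InnerProductSpace ℝ H] [CompleteSpace H]
  {μ L : ℝ} {f : H → ℝ} {g : H → EReal}

/-- The gradient at `y` of `f` recentred at `us`, that is, of
`f - ⟪∇f(us), · - us⟫ - μ/2 ‖· - us‖²`, a smooth convex function minimal at `us`. -/
noncomputable def centredGradient (μ : ℝ) (f : H → ℝ) (us y : H) : H :=
  gradient f y - gradient f us - μ • (y - us)

/-- The slack at `y` of the interpolation inequality between `y` and `us`. -/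
noncomputable def interpolationSlack (μ L : ℝ) (f : H → ℝ) (us y : H) : ℝ :=
  f y - f us - inner ℝ (gradient f us) (y - us) - μ / 2 * ‖y - us‖ ^ 2 -
    1 / (2 * (L - μ)) * ‖centredGradient μ f us y‖ ^ 2

namespace SmoothStronglyConvex

lemma interpolationSlack_nonneg (hf : SmoothStronglyConvex μ L f) (hμL : μ < L) (us y : H) :
    0 ≤ interpolationSlack μ L f us y := by
  have h := hf.interpolation hμL y us
  unfold interpolationSlack centredGradient
  linarith

/-- The interpolation inequality between two gradient calls, in terms of the slacks. -/
lemma interpolationSlack_le (hf : SmoothStronglyConvex μ L f) (hμL : μ < L) (us x y : H) :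
    interpolationSlack μ L f us y ≤ interpolationSlack μ L f us x +
      inner ℝ (centredGradient μ f us y) ((y - us) - ((x - us) -
        (1 / (L - μ)) • centredGradient μ f us x)) -
      ‖centredGradient μ f us y‖ ^ 2 / (L - μ) := by
  have hl : 0 < L - μ := sub_pos.2 hμL
  have h := hf.interpolation hμL x y
  have hxy : gradient f x - gradient f y - μ • (x - y) =
      centredGradient μ f us x - centredGradient μ f us y := by
    unfold centredGradient; module
  have hy : gradient f y = centredGradient μ f us y + gradient f us + μ • (y - us) := by
    unfold centredGradient; module
  rw [hxy, hy, show x - y = (x - us) - (y - us) by abel] at h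
  unfold interpolationSlack
  have e1 : ‖centredGradient μ f us y‖ ^ 2 / (L - μ) =
      2 * (1 / (2 * (L - μ)) * ‖centredGradient μ f us y‖ ^ 2) := by field_simp
  have e2 : 1 / (L - μ) = 2 * (1 / (2 * (L - μ))) := by field_simp
  rw [e1, e2]
  generalize centredGradient μ f us x = p at h ⊢
  generalize centredGradient μ f us y = p' at h ⊢
  generalize x - us = x' at h ⊢
  generalize y - us = y' at h ⊢
  rw [norm_sub_sq_real, norm_sub_sq_real, real_inner_comm p' p, real_inner_comm y' x'] at h
  simp only [inner_add_left, inner_sub_right, real_inner_smul_left, real_inner_smul_right,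
    real_inner_self_eq_norm_sq] at h ⊢
  linarith

lemma interpolationSlack_le_inner (hf : SmoothStronglyConvex μ L f) (hμL : μ < L) (us y : H) :
    interpolationSlack μ L f us y ≤ inner ℝ (centredGradient μ f us y) (y - us) -
      ‖centredGradient μ f us y‖ ^ 2 / (L - μ) := by
  simpa [interpolationSlack, centredGradient] using hf.interpolationSlack_le hμL us us y

end SmoothStronglyConvex

/-- Along Prox-ITEM the potential stays below its initial value. The other conjuncts record the
inequalities at the current iterate that the next step uses. -/
lemma potential_proxItemIter_le (hμ : 0 < μ) (hμL : μ < L) (hf : SmoothStronglyConvex μ L f)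
    (hg : ConvexProperLsc g) {us : H} {gs : ℝ} (hgs : g us = gs)
    (hsub : ∀ (w : H) (r : ℝ), g w = r → gs - inner ℝ (gradient f us) (w - us) ≤ r)
    (u₀ : H) (k : ℕ) :
    ∃ (xt h : H) (e r : ℝ), 0 ≤ e ∧ 0 ≤ r ∧
      seqA (μ / L) k * r ≤
        seqA (μ / L) k * inner ℝ h ((proxItemIter μ L f g u₀ k).2 - us) ∧
      (proxItemIter μ L f g u₀ k).1 - us = (1 - μ / L) • xt - (1 / L) • h ∧
      (∀ y, seqA (μ / L) k * interpolationSlack μ L f us y ≤ seqA (μ / L) k *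
        (e + inner ℝ (centredGradient μ f us y) ((y - us) - xt) -
          ‖centredGradient μ f us y‖ ^ 2 / ((1 - μ / L) * L))) ∧
      (∀ (w : H) (s : ℝ), g w = s →
        seqA (μ / L) k * inner ℝ h ((w - us) - ((proxItemIter μ L f g u₀ k).2 - us)) ≤
          seqA (μ / L) k * ((s - gs + inner ℝ (gradient f us) (w - us)) - r)) ∧
      potential (μ / L) L (seqA (μ / L) k) ((proxItemIter μ L f g u₀ k).2 - us) h e r ≤
        ‖u₀ - us‖ ^ 2 := by
  have hL : 0 < L := hμ.trans hμL
  have hq0 : 0 < μ / L := div_pos hμ hL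
  have hq1 : μ / L < 1 := (div_lt_one hL).2 hμL
  have hl : (1 - μ / L) * L = L - μ := by field_simp
  induction k with
  | zero =>
    -- there is no previous gradient call; the ghost data only has to reproduce `x^0 = u₀`
    refine ⟨(1 - μ / L)⁻¹ • (u₀ - us), 0, 0, 0, le_rfl, le_rfl, ?_, ?_, ?_, ?_, ?_⟩
    · simp [seqA]
    · rw [smul_smul, mul_inv_cancel₀ (by linarith)]
      simp [proxItemIter]
    · simp [seqA]
    · simp [seqA]
    · simp [seqA, potential, proxItemIter]
  | succ k ih =>
    obtain ⟨xt, h, e, r, -, hr, -, hx, he2, hg1, hpot⟩ := ih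
    set q := μ / L with hq
    have hμq : μ = q * L := by rw [hq]; field_simp
    have hA := seqA_nonneg hq0 k
    have hAA' := seqA_le_succ hq0 hq1 k
    have hA' : 0 < seqA q (k + 1) := by
      have := one_lt_seqA_succ hq0 hq1 k
      by_contra! h0
      nlinarith
    have hδ := one_lt_seqDelta hq0 hq1 k
    have hδ0 : 0 < seqDelta q k := by linarith
    set x := (proxItemIter μ L f g u₀ k).1 with hxdef
    set z := (proxItemIter μ L f g u₀ k).2 with hzdef
    set δ := seqDelta q k with hδdef
    obtain ⟨y, hy⟩ : ∃ y, y = (1 - seqBeta q k) • z + seqBeta q k • x := ⟨_, rfl⟩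
    obtain ⟨zb, hzb⟩ : ∃ zb, zb = (1 - q * δ) • z + (q * δ) • y - (δ / L) • gradient f y :=
      ⟨_, rfl⟩
    obtain ⟨z', hz'⟩ : ∃ z', z' = prox g (δ / L) zb := ⟨_, rfl⟩
    have hz1 : (proxItemIter μ L f g u₀ (k + 1)).2 = z' := by
      simp only [proxItemIter]; rw [hz', hzb, hy]
    have hx1 : (proxItemIter μ L f g u₀ (k + 1)).1 =
        y - (1 / L) • gradient f y - (1 / δ) • (zb - z') := by
      simp only [proxItemIter]; rw [hz', hzb, hy]
    have hγ : 0 < δ / L := div_pos hδ0 hL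
    have hprox : IsProx g (δ / L) zb z' := by
      rw [hz']
      exact Classical.epsilon_spec (exists_isProx hg hγ zb hsub)
    obtain ⟨gp, hgp, hgsub⟩ := hprox.subgradient hg hγ
    obtain ⟨p, hp⟩ : ∃ p, p = centredGradient μ f us y := ⟨_, rfl⟩
    have hgrad : gradient f y = p + gradient f us + μ • (y - us) := by
      rw [hp]; unfold centredGradient; module
    -- the subgradient at `z'` of `g` recentred by the slope `∇f(us)`
    obtain ⟨h', hh'⟩ : ∃ h', h' = (1 / (δ / L)) • (zb - z') + gradient f us := ⟨_, rfl⟩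
    have hzz' : zb - z' = (δ / L) • (h' - gradient f us) := by
      rw [hh', add_sub_cancel_right, smul_smul, mul_one_div_cancel hγ.ne', one_smul]
    have hz'us : z' - us = (1 - q * δ) • (z - us) - (δ / L) • (p + h') := by
      have h1 : z' = zb - (δ / L) • (h' - gradient f us) := by rw [← hzz']; abel
      rw [h1, hzb, hgrad, hμq]
      match_scalars <;> field_simp <;> ring
    have hx'us : y - (1 / L) • gradient f y - (1 / δ) • (zb - z') - us =
        (1 - q) • ((y - us) - (1 / (L - μ)) • p) - (1 / L) • h' := by
      have h1q : (1 - q) ≠ 0 := by linarith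
      rw [hzz', hgrad, ← hl, hμq]
      match_scalars <;> field_simp <;> ring
    have hyus : y - us = (1 - seqA q k / ((1 - q) * seqA q (k + 1))) • (z - us) +
        (seqA q k / ((1 - q) * seqA q (k + 1))) • (x - us) := by
      rw [hy, seqBeta]; module
    have hg' : 0 ≤ gp - gs + inner ℝ (gradient f us) (z' - us) := by
      have := hsub z' gp hgp; linarith
    have hinner : ∀ w : H, inner ℝ ((1 / (δ / L)) • (zb - z')) w =
        inner ℝ h' w - inner ℝ (gradient f us) w := by
      intro w; rw [hh', inner_add_left]; ring
    have hg2 : gp - gs + inner ℝ (gradient f us) (z' - us) ≤ inner ℝ h' (z' - us) := by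
      have := hgsub us gs hgs
      rw [hinner, ← neg_sub z' us, inner_neg_right, inner_neg_right] at this
      linarith
    have hstep := potential_step hL hq0 hq1 hδ (mul_seqDelta_lt_one hq0 hq1 k) hA hAA' hA'
      (seqDelta_sq hq0 k) (two_mul_seqDelta hq0 hq1 k) hx hyus hz'us
      (e' := interpolationSlack μ L f us y)
      (by rw [hl, hp]; exact hf.interpolationSlack_le_inner hμL us y)
      (by rw [hp]; exact he2 y) (hg1 z' gp hgp) hg2 hg' hr
    rw [hz1, hx1]
    refine ⟨(y - us) - (1 / (L - μ)) • p, h', interpolationSlack μ L f us y,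
      gp - gs + inner ℝ (gradient f us) (z' - us),
      hf.interpolationSlack_nonneg hμL us y, hg', mul_le_mul_of_nonneg_left hg2 hA'.le,
      hx'us, fun y' => mul_le_mul_of_nonneg_left ?_ hA'.le,
      fun w s hs => mul_le_mul_of_nonneg_left ?_ hA'.le, hstep.trans hpot⟩
    · rw [hl, hp]
      exact hf.interpolationSlack_le hμL us y y'
    · have := hgsub w s hs
      rw [hinner] at this
      rw [sub_sub_sub_cancel_right]
      have h2 : inner ℝ (gradient f us) (w - us) = inner ℝ (gradient f us) (w - z') +
          inner ℝ (gradient f us) (z' - us) := by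
        rw [← inner_add_right]; congr 1; abel
      linarith

lemma norm_proxItem_sub_sq_le (hμ : 0 < μ) (hμL : μ < L) (hf : SmoothStronglyConvex μ L f)
    (hg : ConvexProperLsc g) {us : H} (hus : IsSolution f g us) (u₀ : H) (k : ℕ) :
    (1 + μ / L * seqA (μ / L) k) * ‖(proxItemIter μ L f g u₀ k).2 - us‖ ^ 2 ≤
      ‖u₀ - us‖ ^ 2 := by
  have hL : 0 < L := hμ.trans hμL
  have hq0 : 0 < μ / L := div_pos hμ hL
  have hq1 : 0 < 1 - μ / L := sub_pos.2 ((div_lt_one hL).2 hμL)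
  have hA := seqA_nonneg hq0 k
  obtain ⟨gs, hgs, hsub⟩ := hg.subgradient_of_isMinOn (hf.hasGradientAt us) hus
  obtain ⟨xt, h, e, r, he, hr, hrh, -, -, -, hpot⟩ :=
    potential_proxItemIter_le hμ hμL hf hg hgs hsub u₀ k
  unfold potential at hpot
  have h1 : 0 ≤ (1 - μ / L) * seqA (μ / L) k / L * e := by positivity
  have h2 : 0 ≤ seqA (μ / L) k / (2 * L ^ 2) * ‖h‖ ^ 2 := by positivity
  have h3 : 0 ≤ μ / L / L * (seqA (μ / L) k *
      inner ℝ h ((proxItemIter μ L f g u₀ k).2 - us) - seqA (μ / L) k * r) :=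
    mul_nonneg (by positivity) (sub_nonneg.2 hrh)
  have h4 : μ / L * seqA (μ / L) k / L *
      (inner ℝ h ((proxItemIter μ L f g u₀ k).2 - us) - r) = μ / L / L * (seqA (μ / L) k *
      inner ℝ h ((proxItemIter μ L f g u₀ k).2 - us) - seqA (μ / L) k * r) := by ring
  linarith

lemma risk_proxItem_le (hμ : 0 < μ) (hμL : μ < L) (k : ℕ) :
    risk.{u} μ L (proxItem.{u} μ L k) ≤
      ENNReal.ofReal (1 / (1 + μ / L * seqA (μ / L) k)) := by
  have hL : 0 < L := hμ.trans hμL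
  have hA := seqA_nonneg (div_pos hμ hL) k
  refine sSup_le ?_
  rintro _ ⟨H, _, _, _, f, g, us, u₀, hf, hg, hus, hne, rfl⟩
  refine ENNReal.ofReal_le_ofReal ?_
  have hpos : 0 < ‖u₀ - us‖ ^ 2 := by
    have := norm_pos_iff.2 (sub_ne_zero.2 hne); positivity
  rw [div_le_div_iff₀ hpos (by positivity), one_mul, mul_comm]
  exact norm_proxItem_sub_sq_le hμ hμL hf hg hus u₀ k

end UpperBound

/-! ### Prox-ITEM obeys the span rule -/

section Membership

variable {H : Type u} [NormedAddCommGroup H] [InnerProductSpace ℝ H] [CompleteSpace H]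

lemma card_filter_even_range (k : ℕ) :
    ((Finset.range (2 * k)).filter fun ℓ => decide (ℓ % 2 = 0) = true).card = k := by
  induction k with
  | zero => simp
  | succ k ih =>
    rw [show 2 * (k + 1) = 2 * k + 1 + 1 by ring, Finset.range_add_one, Finset.range_add_one,
      Finset.filter_insert, Finset.filter_insert]
    simp only [decide_eq_true_eq] at ih ⊢
    rw [if_neg (by omega), if_pos (by omega), Finset.card_insert_of_notMem (by simp), ih]

lemma spanReachable_proxItemIter {μ L : ℝ} (hμ : 0 < μ) (hμL : μ < L) (f : H → ℝ) (g : H → EReal)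
    (u₀ : H) (k : ℕ) : SpanReachable k f g u₀ (proxItemIter μ L f g u₀ k).2 := by
  have hL : 0 < L := hμ.trans hμL
  let q : ℝ := μ / L
  let δ : ℕ → ℝ := seqDelta q
  have hδ : ∀ i, 0 < δ i := fun i =>
    zero_lt_one.trans (one_lt_seqDelta (div_pos hμ hL) ((div_lt_one hL).2 hμL) i)
  let x : ℕ → H := fun i => (proxItemIter μ L f g u₀ i).1
  let z : ℕ → H := fun i => (proxItemIter μ L f g u₀ i).2
  let y : ℕ → H := fun i => (1 - seqBeta q i) • z i + seqBeta q i • x i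
  let zb : ℕ → H := fun i =>
    (1 - q * δ i) • z i + (q * δ i) • y i - (δ i / L) • gradient f (y i)
  have hz : ∀ i, z (i + 1) = prox g (δ i / L) (zb i) := fun i => rfl
  have hx : ∀ i, x (i + 1) =
      y i - (1 / L) • gradient f (y i) - (1 / δ i) • (zb i - z (i + 1)) := fun i => rfl
  -- iteration `i` makes the gradient call `2 i` at `y i` and the proximal call `2 i + 1` at `zb i`
  let v : ℕ → H := fun ℓ => if ℓ % 2 = 0 then y (ℓ / 2) else zb (ℓ / 2)
  let s : ℕ → H := fun ℓ => if ℓ % 2 = 0 then gradient f (y (ℓ / 2)) else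
    (δ (ℓ / 2) / L)⁻¹ • (zb (ℓ / 2) - prox g (δ (ℓ / 2) / L) (zb (ℓ / 2)))
  let W : ℕ → Submodule ℝ H := fun n => Submodule.span ℝ (s '' {i | i < n})
  have hW : Monotone W := fun a b hab =>
    Submodule.span_mono (image_mono fun i (hi : i < a) => hi.trans_le hab)
  have hsW : ∀ i n, i < n → s i ∈ W n := fun i n hi =>
    Submodule.subset_span (mem_image_of_mem s hi)
  have hy : ∀ i, x i - u₀ ∈ W (2 * i) → z i - u₀ ∈ W (2 * i) → y i - u₀ ∈ W (2 * i) := by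
    intro i h1 h2
    rw [show y i - u₀ = (1 - seqBeta q i) • (z i - u₀) + seqBeta q i • (x i - u₀) by
      simp only [y]; module]
    exact add_mem (Submodule.smul_mem _ _ h2) (Submodule.smul_mem _ _ h1)
  have hgrad : ∀ i, gradient f (y i) ∈ W (2 * i + 1) := by
    intro i
    have := hsW (2 * i) (2 * i + 1) (by omega)
    simpa [s] using this
  have hzb : ∀ i, x i - u₀ ∈ W (2 * i) → z i - u₀ ∈ W (2 * i) → zb i - u₀ ∈ W (2 * i + 1) := by
    intro i h1 h2
    rw [show zb i - u₀ = (1 - q * δ i) • (z i - u₀) + (q * δ i) • (y i - u₀) -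
      (δ i / L) • gradient f (y i) by simp only [zb]; module]
    exact sub_mem (add_mem (Submodule.smul_mem _ _ (hW (Nat.le_succ _) h2))
      (Submodule.smul_mem _ _ (hW (Nat.le_succ _) (hy i h1 h2))))
      (Submodule.smul_mem _ _ (hgrad i))
  have hdiff : ∀ i, zb i - z (i + 1) ∈ W (2 * (i + 1)) := by
    intro i
    have h1 := hsW (2 * i + 1) (2 * (i + 1)) (by omega)
    have h2 : s (2 * i + 1) = (δ i / L)⁻¹ • (zb i - z (i + 1)) := by
      have h3 : (2 * i + 1) / 2 = i := by omega
      simp only [s]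
      rw [if_neg (by omega), h3, hz]
    have h3 : zb i - z (i + 1) = (δ i / L) • s (2 * i + 1) := by
      rw [h2, smul_smul, mul_inv_cancel₀ (div_pos (hδ i) hL).ne', one_smul]
    rw [h3]
    exact Submodule.smul_mem _ _ h1
  have hxz : ∀ i, x i - u₀ ∈ W (2 * i) ∧ z i - u₀ ∈ W (2 * i) := by
    intro i
    induction i with
    | zero => simp [x, z, proxItemIter]
    | succ i ih =>
      obtain ⟨h1, h2⟩ := ih
      constructor
      · rw [hx, show y i - (1 / L) • gradient f (y i) - (1 / δ i) • (zb i - z (i + 1)) - u₀ =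
          (y i - u₀) - (1 / L) • gradient f (y i) - (1 / δ i) • (zb i - z (i + 1)) by abel]
        exact sub_mem (sub_mem (hW (by omega) (hy i h1 h2))
          (Submodule.smul_mem _ _ (hW (by omega) (hgrad i)))) (Submodule.smul_mem _ _ (hdiff i))
      · rw [show z (i + 1) - u₀ = (zb i - u₀) - (zb i - z (i + 1)) by abel]
        exact sub_mem (hW (by omega) (hzb i h1 h2)) (hdiff i)
  refine ⟨2 * k, fun ℓ => decide (ℓ % 2 = 0), fun ℓ => δ (ℓ / 2) / L, v, s, by omega,
    card_filter_even_range k, ?_, ?_, ?_, ?_, (hxz k).2⟩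
  · simp only [v, y, x, z, Nat.zero_mod, if_true, Nat.zero_div, proxItemIter]
    module
  · intro ℓ _ hθ
    have h : ℓ % 2 = 0 := by simpa using hθ
    simp [s, v, h]
  · intro ℓ _ hθ
    have h : ¬ ℓ % 2 = 0 := by simpa using hθ
    refine ⟨div_pos (hδ _) hL, ?_⟩
    simp only [s, v, if_neg h]
  · intro ℓ _ _
    obtain ⟨h1, h2⟩ := hxz (ℓ / 2)
    change v ℓ - u₀ ∈ W ℓ
    by_cases h : ℓ % 2 = 0
    · simp only [v, if_pos h]
      exact hW (by omega) (hy _ h1 h2)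
    · simp only [v, if_neg h]
      exact hW (by omega) (hzb _ h1 h2)

lemma proxItem_mem_spanMethods {μ L : ℝ} (hμ : 0 < μ) (hμL : μ < L) (k : ℕ) :
    proxItem.{u} μ L k ∈ spanMethods.{u} k μ L :=
  fun _ _ _ _ f g u₀ _ _ => spanReachable_proxItemIter hμ hμL f g u₀ k

end Membership

/-! ### Smoothed maxima of affine functions -/

section SmoothMax

variable {H : Type u} [NormedAddCommGroup H] [InnerProductSpace ℝ H]
  {J : Type*} [Fintype J] {a : J → H} {b : J → ℝ} {l : ℝ}

/-- The dual objective of the Moreau envelope at `x` of `max_j (⟪a j, ·⟫ - b j)`, as a function of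
the weights `α` on the affine pieces. -/
noncomputable def dualValue (a : J → H) (b : J → ℝ) (l : ℝ) (x : H) (α : J → ℝ) : ℝ :=
  ∑ j, α j * (inner ℝ (a j) x - b j) - 1 / (2 * l) * ‖∑ j, α j • a j‖ ^ 2

/-- The value of the `j`-th affine piece at the proximal point `x - l⁻¹ ∑ i, α i • a i`. -/
noncomputable def pieceValue (a : J → H) (b : J → ℝ) (l : ℝ) (x : H) (α : J → ℝ) (j : J) : ℝ :=
  inner ℝ (a j) (x - (1 / l) • ∑ i, α i • a i) - b j

/-- Optimality of the weights `α` in the dual of the Moreau envelope at `x`: they average the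
values of the pieces at the proximal point to the maximal value. -/
structure IsDualOptimal (a : J → H) (b : J → ℝ) (l : ℝ) (x : H) (α : J → ℝ) : Prop where
  mem : α ∈ stdSimplex ℝ J
  le : ∀ j, pieceValue a b l x α j ≤ ∑ i, α i * pieceValue a b l x α i

lemma sum_mul_pieceValue (x : H) (α β : J → ℝ) :
    ∑ j, β j * pieceValue a b l x α j = ∑ j, β j * (inner ℝ (a j) x - b j) -
      1 / l * inner ℝ (∑ j, β j • a j) (∑ i, α i • a i) := by
  rw [sum_inner, Finset.mul_sum, ← Finset.sum_sub_distrib]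
  refine Finset.sum_congr rfl fun j _ => ?_
  rw [pieceValue, inner_sub_right, real_inner_smul_right, real_inner_smul_left]
  ring

/-- The dual objective is a concave quadratic; this is its exact expansion at `α`. -/
lemma dualValue_sub_dualValue (x : H) (α β : J → ℝ) :
    dualValue a b l x β - dualValue a b l x α =
      ∑ j, β j * pieceValue a b l x α j - ∑ j, α j * pieceValue a b l x α j -
        1 / (2 * l) * ‖∑ j, β j • a j - ∑ j, α j • a j‖ ^ 2 := by
  rw [sum_mul_pieceValue, sum_mul_pieceValue, dualValue, dualValue, norm_sub_sq_real,
    real_inner_self_eq_norm_sq]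
  ring

lemma exists_isDualOptimal [Nonempty J] (a : J → H) (b : J → ℝ) (l : ℝ) (x : H) :
    ∃ α, IsDualOptimal a b l x α := by
  classical
  have hne : (stdSimplex ℝ J).Nonempty :=
    ⟨_, single_mem_stdSimplex ℝ (Classical.arbitrary J)⟩
  have hcont : Continuous (dualValue a b l x) := by unfold dualValue; fun_prop
  obtain ⟨α, hα, hmax⟩ := (isCompact_stdSimplex ℝ J).exists_isMaxOn hne hcont.continuousOn
  refine ⟨α, hα, fun j => ?_⟩
  set S := ∑ i, α i * pieceValue a b l x α i with hS
  have key : ∀ t : ℝ, 0 < t → t ≤ 1 → pieceValue a b l x α j - S ≤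
      t * (1 / (2 * l) * ‖a j - ∑ i, α i • a i‖ ^ 2) := by
    intro t ht0 ht1
    -- move mass `t` of the weights to the piece `j`
    have hβ : (1 - t) • α + t • (Pi.single j 1 : J → ℝ) ∈ stdSimplex ℝ J :=
      convex_stdSimplex ℝ J hα (single_mem_stdSimplex ℝ j) (by linarith) ht0.le (by ring)
    have h1 : dualValue a b l x ((1 - t) • α + t • (Pi.single j 1 : J → ℝ)) -
        dualValue a b l x α ≤ 0 := sub_nonpos.2 (hmax hβ)
    have h2 : ∑ i, ((1 - t) • α + t • (Pi.single j 1 : J → ℝ)) i • a i =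
        (1 - t) • ∑ i, α i • a i + t • a j := by
      simp [add_smul, Finset.sum_add_distrib, Finset.smul_sum, mul_smul, Pi.single_apply]
    have h3 : ∑ i, ((1 - t) • α + t • (Pi.single j 1 : J → ℝ)) i * pieceValue a b l x α i =
        (1 - t) * S + t * pieceValue a b l x α j := by
      simp [add_mul, Finset.sum_add_distrib, Finset.mul_sum, mul_assoc, Pi.single_apply, hS]
    rw [dualValue_sub_dualValue, h2, h3, show (1 - t) • ∑ i, α i • a i + t • a j -
      ∑ i, α i • a i = t • (a j - ∑ i, α i • a i) by module, norm_smul, mul_pow,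
      Real.norm_of_nonneg ht0.le] at h1
    have h4 : t * (pieceValue a b l x α j - S) ≤
        t * (t * (1 / (2 * l) * ‖a j - ∑ i, α i • a i‖ ^ 2)) := by nlinarith
    exact le_of_mul_le_mul_left h4 ht0
  have h0 : Filter.Tendsto (fun t : ℝ => t * (1 / (2 * l) * ‖a j - ∑ i, α i • a i‖ ^ 2))
      (nhdsWithin 0 (Ioi 0)) (nhds 0) := by
    have : Continuous fun t : ℝ => t * (1 / (2 * l) * ‖a j - ∑ i, α i • a i‖ ^ 2) := by fun_prop
    simpa using (this.tendsto 0).mono_left nhdsWithin_le_nhds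
  refine sub_nonpos.1 (ge_of_tendsto h0 ?_)
  filter_upwards [Ioo_mem_nhdsGT (zero_lt_one' ℝ)] with t ht using key t ht.1 ht.2.le

namespace IsDualOptimal

variable {x : H} {α β : J → ℝ}

lemma dualValue_le (hα : IsDualOptimal a b l x α) (hβ : β ∈ stdSimplex ℝ J) :
    dualValue a b l x β + 1 / (2 * l) * ‖∑ j, β j • a j - ∑ j, α j • a j‖ ^ 2 ≤
      dualValue a b l x α := by
  have h := dualValue_sub_dualValue (a := a) (b := b) (l := l) x α β
  have h1 : ∑ j, β j * pieceValue a b l x α j ≤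
      ∑ j, β j * ∑ i, α i * pieceValue a b l x α i :=
    Finset.sum_le_sum fun j _ => mul_le_mul_of_nonneg_left (hα.le j) (hβ.1 j)
  rw [← Finset.sum_mul, hβ.2, one_mul] at h1
  linarith

/-- Complementary slackness. -/
lemma pieceValue_eq (hα : IsDualOptimal a b l x α) {j : J} (hj : α j ≠ 0) :
    pieceValue a b l x α j = ∑ i, α i * pieceValue a b l x α i := by
  set S := ∑ i, α i * pieceValue a b l x α i with hS
  have h0 : ∑ i, α i * (S - pieceValue a b l x α i) = 0 := by
    simp only [mul_sub, Finset.sum_sub_distrib]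
    rw [← Finset.sum_mul, hα.mem.2, one_mul, ← hS, sub_self]
  have h1 := (Finset.sum_eq_zero_iff_of_nonneg fun i _ =>
    mul_nonneg (hα.mem.1 i) (sub_nonneg.2 (hα.le i))).1 h0 j (Finset.mem_univ j)
  have h2 := (mul_eq_zero.1 h1).resolve_left hj
  linarith

end IsDualOptimal

variable [Nonempty J]

/-- Chosen optimal weights for the Moreau envelope at `x`. -/
noncomputable def dualWeights (a : J → H) (b : J → ℝ) (l : ℝ) (x : H) : J → ℝ :=
  (exists_isDualOptimal a b l x).choose

lemma isDualOptimal_dualWeights (a : J → H) (b : J → ℝ) (l : ℝ) (x : H) :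
    IsDualOptimal a b l x (dualWeights a b l x) :=
  (exists_isDualOptimal a b l x).choose_spec

/-- The Moreau envelope with parameter `1 / l` of `max_j (⟪a j, ·⟫ - b j)`. -/
noncomputable def smoothMax (a : J → H) (b : J → ℝ) (l : ℝ) (x : H) : ℝ :=
  dualValue a b l x (dualWeights a b l x)

/-- The gradient of the smoothed maximum: the average of the slopes with the optimal weights. -/
noncomputable def smoothMaxGradient (a : J → H) (b : J → ℝ) (l : ℝ) (x : H) : H :=
  ∑ j, dualWeights a b l x j • a j

lemma smoothMax_eq (hl : 0 < l) {x : H} {α : J → ℝ} (hα : IsDualOptimal a b l x α) :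
    smoothMax a b l x = dualValue a b l x α := by
  refine le_antisymm ?_ ?_
  · have := hα.dualValue_le (isDualOptimal_dualWeights a b l x).mem
    exact (le_add_of_nonneg_right (by positivity)).trans this
  · have := (isDualOptimal_dualWeights a b l x).dualValue_le hα.mem
    exact (le_add_of_nonneg_right (by positivity)).trans this

lemma dualValue_le_smoothMax (hl : 0 < l) (x : H) {α : J → ℝ} (hα : α ∈ stdSimplex ℝ J) :
    dualValue a b l x α ≤ smoothMax a b l x :=
  (le_add_of_nonneg_right (by positivity)).trans
    ((isDualOptimal_dualWeights a b l x).dualValue_le hα)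

lemma smoothMax_interpolation (a : J → H) (b : J → ℝ) (l : ℝ) (x y : H) :
    smoothMax a b l x + inner ℝ (smoothMaxGradient a b l x) (y - x) +
      1 / (2 * l) * ‖smoothMaxGradient a b l x - smoothMaxGradient a b l y‖ ^ 2 ≤
        smoothMax a b l y := by
  have h := (isDualOptimal_dualWeights a b l y).dualValue_le
    (isDualOptimal_dualWeights a b l x).mem
  have h1 : dualValue a b l y (dualWeights a b l x) =
      smoothMax a b l x + inner ℝ (smoothMaxGradient a b l x) (y - x) := by
    rw [smoothMax, dualValue, dualValue, smoothMaxGradient, sum_inner]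
    have : ∑ j, dualWeights a b l x j * (inner ℝ (a j) y - b j) =
        ∑ j, dualWeights a b l x j * (inner ℝ (a j) x - b j) +
          ∑ j, inner ℝ (dualWeights a b l x j • a j) (y - x) := by
      rw [← Finset.sum_add_distrib]
      refine Finset.sum_congr rfl fun j _ => ?_
      rw [real_inner_smul_left, inner_sub_right]
      ring
    rw [this]
    ring
  rw [h1] at h
  exact h

end SmoothMax

section AddQuadratic

variable {H : Type u} [NormedAddCommGroup H] [InnerProductSpace ℝ H] [CompleteSpace H]
  {μ l : ℝ} {h : H → ℝ} {G : H → H}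

/-- A function that satisfies the interpolation inequality of smooth convex functions is
differentiable, and `G` is its gradient. -/
lemma hasGradientAt_of_interpolation (hl : 0 < l)
    (hG : ∀ x y, h x + inner ℝ (G x) (y - x) + 1 / (2 * l) * ‖G x - G y‖ ^ 2 ≤ h y) (x : H) :
    HasGradientAt h (G x) x := by
  have hup : ∀ y, h y ≤ h x + inner ℝ (G x) (y - x) + l / 2 * ‖y - x‖ ^ 2 := by
    intro y
    have h1 := hG y x
    have h2 : inner ℝ (G y) (x - y) = - inner ℝ (G x) (y - x) - inner ℝ (G y - G x) (y - x) := by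
      rw [inner_sub_left, ← neg_sub y x, inner_neg_right]; ring
    have h3 := real_inner_le_norm (G y - G x) (y - x)
    have h4 : 0 ≤ 1 / (2 * l) * (‖G y - G x‖ - l * ‖y - x‖) ^ 2 := by positivity
    have h5 : 1 / (2 * l) * (‖G y - G x‖ - l * ‖y - x‖) ^ 2 =
        1 / (2 * l) * ‖G y - G x‖ ^ 2 - ‖G y - G x‖ * ‖y - x‖ + l / 2 * ‖y - x‖ ^ 2 := by
      field_simp; ring
    linarith
  rw [hasGradientAt_iff_isLittleO]
  have hO : (fun y => h y - h x - inner ℝ (G x) (y - x)) =O[nhds x] fun y => ‖y - x‖ ^ 2 := by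
    refine Asymptotics.IsBigO.of_bound (l / 2) (Filter.Eventually.of_forall fun y => ?_)
    have h1 := hG x y
    have h2 : 0 ≤ 1 / (2 * l) * ‖G x - G y‖ ^ 2 := by positivity
    rw [Real.norm_of_nonneg (by linarith), Real.norm_of_nonneg (by positivity)]
    linarith [hup y]
  refine hO.trans_isLittleO ?_
  have h1 : (fun y : H => ‖y - x‖) =o[nhds x] fun _ => (1 : ℝ) := by
    rw [Asymptotics.isLittleO_one_iff]
    have : Continuous fun y : H => ‖y - x‖ := by fun_prop
    simpa using this.tendsto x
  have h2 : (fun y : H => ‖y - x‖ * ‖y - x‖) =o[nhds x] fun y => 1 * ‖y - x‖ :=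
    h1.mul_isBigO (Asymptotics.isBigO_refl _ _)
  simpa [pow_two, Asymptotics.isLittleO_norm_right] using h2

lemma hasGradientAt_quadratic_add (hh : ∀ x, HasGradientAt h (G x) x) (x : H) :
    HasGradientAt (fun x => μ / 2 * ‖x‖ ^ 2 + h x) (μ • x + G x) x := by
  have h1 := ((hasFDerivAt_id x).norm_sq).const_mul (μ / 2)
  have h2 := h1.add (hh x).hasFDerivAt
  rw [hasGradientAt_iff_hasFDerivAt]
  refine h2.congr_fderiv ?_
  ext w
  simp
  ring

lemma smoothStronglyConvex_quadratic_add (hμ : 0 ≤ μ) (hl : 0 < l)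
    (hG : ∀ x y, h x + inner ℝ (G x) (y - x) + 1 / (2 * l) * ‖G x - G y‖ ^ 2 ≤ h y) :
    SmoothStronglyConvex μ (μ + l) fun x => μ / 2 * ‖x‖ ^ 2 + h x := by
  have hgrad := fun x =>
    hasGradientAt_quadratic_add (μ := μ) (hasGradientAt_of_interpolation hl hG) x
  have hsub : ∀ x y, h x + inner ℝ (G x) (y - x) ≤ h y := fun x y =>
    (le_add_of_nonneg_right (by positivity)).trans (hG x y)
  refine ⟨?_, fun x => (hgrad x).differentiableAt, fun x y => ?_⟩
  · rw [strongConvexOn_iff_convex]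
    simp only [add_sub_cancel_left]
    refine ⟨convex_univ, fun x _ y _ s t hs ht hst => ?_⟩
    have h1 := mul_le_mul_of_nonneg_left (hsub (s • x + t • y) x) hs
    have h2 := mul_le_mul_of_nonneg_left (hsub (s • x + t • y) y) ht
    have h3 : s * inner ℝ (G (s • x + t • y)) (x - (s • x + t • y)) +
        t * inner ℝ (G (s • x + t • y)) (y - (s • x + t • y)) = 0 := by
      rw [← real_inner_smul_right, ← real_inner_smul_right, ← inner_add_right]
      have : s • (x - (s • x + t • y)) + t • (y - (s • x + t • y)) =
          (1 - (s + t)) • (s • x + t • y) := by module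
      rw [this, hst, sub_self, zero_smul, inner_zero_right]
    have h4 : s * h (s • x + t • y) + t * h (s • x + t • y) = h (s • x + t • y) := by
      rw [← add_mul, hst, one_mul]
    simp only [smul_eq_mul]
    linarith
  · rw [(hgrad x).gradient, (hgrad y).gradient]
    have h1 := hG x y
    have h2 := hG y x
    rw [norm_sub_rev (G y) (G x)] at h2
    have h3 : inner ℝ (G x) (y - x) + inner ℝ (G y) (x - y) = - inner ℝ (G x - G y) (x - y) := by
      rw [inner_sub_left, ← neg_sub x y, inner_neg_right]; ring
    have h4 := real_inner_le_norm (G x - G y) (x - y)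
    have h5 : 1 / l * ‖G x - G y‖ ^ 2 ≤ ‖G x - G y‖ * ‖x - y‖ := by
      have : 1 / l * ‖G x - G y‖ ^ 2 = 2 * (1 / (2 * l) * ‖G x - G y‖ ^ 2) := by field_simp
      linarith
    have h6 : ‖G x - G y‖ ≤ l * ‖x - y‖ := by
      rcases (norm_nonneg (G x - G y)).eq_or_lt with h0 | h0
      · rw [← h0]; positivity
      · have h7 : ‖G x - G y‖ * ‖G x - G y‖ ≤ ‖G x - G y‖ * (l * ‖x - y‖) := by
          have := mul_le_mul_of_nonneg_left h5 hl.le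
          rw [← mul_assoc, mul_one_div_cancel hl.ne', one_mul] at this
          nlinarith
        exact le_of_mul_le_mul_left h7 h0
    calc ‖μ • x + G x - (μ • y + G y)‖ = ‖μ • (x - y) + (G x - G y)‖ := by congr 1; module
      _ ≤ ‖μ • (x - y)‖ + ‖G x - G y‖ := norm_add_le _ _
      _ ≤ μ * ‖x - y‖ + l * ‖x - y‖ := by
        rw [norm_smul, Real.norm_of_nonneg hμ]; gcongr
      _ = (μ + l) * ‖x - y‖ := by ring

end AddQuadratic

/-! ### The resisting instance -/

section SpanRule

lemma convexProperLsc_zero {H : Type u} [NormedAddCommGroup H] [InnerProductSpace ℝ H] :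
    ConvexProperLsc fun _ : H => (0 : EReal) where
  ne_bot _ := EReal.zero_ne_bot
  proper := ⟨0, EReal.zero_ne_top⟩
  convex _ _ _ _ _ := by simp
  lsc := lowerSemicontinuous_const

lemma prox_zero {H : Type u} [NormedAddCommGroup H] {γ : ℝ} (hγ : 0 < γ) (x : H) :
    prox (fun _ => (0 : EReal)) γ x = x := by
  have hc : 0 < 1 / (2 * γ) := by positivity
  have hex : ∃ p, IsProx (fun _ : H => (0 : EReal)) γ x p := by
    refine ⟨x, fun z _ => ?_⟩
    simp only [mem_ofPred_eq, zero_add, EReal.coe_le_coe_iff, sub_self, norm_zero]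
    simp only [ne_eq, OfNat.ofNat_ne_zero, not_false_eq_true, zero_pow, mul_zero]
    positivity
  have h := Classical.epsilon_spec hex (mem_univ x)
  simp only [mem_ofPred_eq, zero_add, EReal.coe_le_coe_iff, sub_self, norm_zero, ne_eq,
    OfNat.ofNat_ne_zero, not_false_eq_true, zero_pow, mul_zero] at h
  have h1 : ‖x - prox (fun _ => (0 : EReal)) γ x‖ ^ 2 ≤ 0 :=
    le_of_mul_le_mul_left (by rw [mul_zero]; exact h) hc
  have h2 : ‖x - prox (fun _ => (0 : EReal)) γ x‖ = 0 := by
    have := sq_nonneg ‖x - prox (fun _ => (0 : EReal)) γ x‖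
    exact pow_eq_zero_iff two_ne_zero |>.1 (le_antisymm h1 this)
  exact (sub_eq_zero.1 (norm_eq_zero.1 h2)).symm

/-- If every gradient call enlarges the space of visible points by at most one step of the chain
`Z`, then `k` gradient calls started at the origin do not leave `Z k`. Proximal calls to `g = 0`
give no information. -/
lemma mem_of_spanReachable {H : Type u} [NormedAddCommGroup H] [InnerProductSpace ℝ H]
    [CompleteSpace H] {f : H → ℝ} {Z : ℕ → Submodule ℝ H} (hZ : Monotone Z)
    (hf : ∀ i, ∀ x ∈ Z i, gradient f x ∈ Z (i + 1)) {k : ℕ} {w : H}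
    (hw : SpanReachable k f (fun _ => 0) 0 w) : w ∈ Z k := by
  obtain ⟨m, θ, γ, v, s, -, hcard, hv0, hgrad, hprox, hv, hw⟩ := hw
  let cnt : ℕ → ℕ := fun n => ((Finset.range n).filter fun ℓ => θ ℓ = true).card
  have hspan : ∀ n, (∀ i < n, s i ∈ Z (cnt n)) →
      Submodule.span ℝ (s '' {i | i < n}) ≤ Z (cnt n) := by
    intro n h
    rw [Submodule.span_le]
    rintro _ ⟨i, hi, rfl⟩
    exact h i hi
  have key : ∀ n ≤ m, ∀ i < n, s i ∈ Z (cnt n) := by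
    intro n
    induction n with
    | zero => intro _ i hi; omega
    | succ n ih =>
      intro hn
      have ih := ih (by omega)
      have hvn : v n ∈ Z (cnt n) := by
        rcases Nat.eq_zero_or_pos n with rfl | hpos
        · rw [hv0]; exact zero_mem _
        · have := hspan n ih (hv n (by omega) hpos)
          simpa using this
      have hcnt : cnt n ≤ cnt (n + 1) :=
        Finset.card_le_card (Finset.filter_subset_filter _
          (Finset.range_subset_range.2 (Nat.le_succ n)))
      intro i hi
      rcases Nat.lt_succ_iff_lt_or_eq.1 hi with hi | rfl
      · exact hZ hcnt (ih i hi)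
      · cases hθ : θ i with
        | true =>
          rw [hgrad i (by omega) hθ]
          have : cnt (i + 1) = cnt i + 1 := by
            simp only [cnt]
            rw [Finset.range_add_one, Finset.filter_insert, if_pos hθ,
              Finset.card_insert_of_notMem (by simp)]
          rw [this]
          exact hf _ _ hvn
        | false =>
          obtain ⟨hγ, hs⟩ := hprox i (by omega) hθ
          rw [hs, prox_zero hγ, sub_self, smul_zero]
          exact zero_mem _
  have h := hspan m (key m le_rfl) hw
  have hk : cnt m = k := hcard
  rwa [sub_zero, hk] at h

end SpanRule

section Chain

/-- The space of the resisting instance, with coordinates `0, …, k`. -/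
abbrev ChainSpace (k : ℕ) : Type u := EuclideanSpace ℝ (ULift.{u} (Fin (k + 1)))

/-- Coordinate `m` of the slope of the `j`-th affine piece. -/
noncomputable def slopeCoord (G c : ℕ → ℝ) (j m : ℕ) : ℝ :=
  if m < j then -G m else if m = j then -c j else 0

/-- The slope of the `j`-th affine piece. Beyond `j` its coordinates vanish, so that the piece
hides the later coordinates; before `j` they agree with those of all later pieces. -/
noncomputable def slope {k : ℕ} (G c : ℕ → ℝ) (j : Fin (k + 1)) : ChainSpace.{u} k :=
  WithLp.toLp 2 fun m => slopeCoord G c j m.down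

/-- The offset of the `j`-th affine piece: the least one for which a point with vanishing
coordinates from `i` on does not activate the pieces after `i`. -/
noncomputable def offset (G c : ℕ → ℝ) (l : ℝ) (j : ℕ) : ℝ :=
  ∑ m ∈ Finset.range j, (c m - G m) * c m / l

/-- The subspace of points whose coordinates vanish from `i` on. -/
def chainSubspace (k i : ℕ) : Submodule ℝ (ChainSpace.{u} k) where
  carrier := {x | ∀ m : ULift.{u} (Fin (k + 1)), i ≤ m.down → x m = 0}
  add_mem' hx hy m hm := by simp [hx m hm, hy m hm]
  zero_mem' m _ := by simp
  smul_mem' r x hx m hm := by simp [hx m hm]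

variable {k : ℕ} {G c : ℕ → ℝ} {l : ℝ}

lemma monotone_chainSubspace : Monotone (chainSubspace.{u} k) :=
  fun _ _ hij _ hx m hm => hx m (hij.trans hm)

@[simp]
lemma slope_apply (j : Fin (k + 1)) (m : ULift.{u} (Fin (k + 1))) :
    slope.{u} G c j m = slopeCoord G c j m.down := rfl

lemma slopeCoord_nonpos (hG : ∀ i ≤ k, 0 < G i) (hc : ∀ i ≤ k, G i ≤ c i) {j m : ℕ}
    (hj : j ≤ k) : slopeCoord G c j m ≤ 0 := by
  unfold slopeCoord
  split_ifs with h1 h2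
  · have := hG m (by omega); linarith
  · have := hG j hj; have := hc j hj; linarith
  · exact le_rfl

lemma neg_le_slopeCoord (hG : ∀ i ≤ k, 0 < G i) (hc : ∀ i ≤ k, G i ≤ c i) {j m : ℕ}
    (hm : m ≤ k) : -c m ≤ slopeCoord G c j m := by
  have := hG m hm
  have := hc m hm
  unfold slopeCoord
  split_ifs with h1 h2
  · linarith
  · rw [h2]
  · linarith

lemma offset_add_le_offset (hl : 0 < l) (hG : ∀ i ≤ k, 0 < G i) (hc : ∀ i ≤ k, G i ≤ c i)
    {i j : ℕ} (hij : i < j) (hj : j ≤ k) :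
    offset G c l i + (c i - G i) * c i / l ≤ offset G c l j := by
  rw [offset, offset, ← Finset.sum_range_succ fun m => (c m - G m) * c m / l]
  refine Finset.sum_le_sum_of_subset_of_nonneg (Finset.range_subset_range.2 hij) fun m hm _ => ?_
  have hm : m < j := Finset.mem_range.1 hm
  have h1 := hG m (by omega)
  have h2 := hc m (by omega)
  exact div_nonneg (mul_nonneg (by linarith) (by linarith)) hl.le

/-- At a point whose coordinates vanish from `i` on, the pieces after `i` carry no weight. All
slopes have nonpositive coordinates, so the proximal point has nonnegative coordinates from `i` on
and piece `i` lies above every later piece that carries weight. -/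
lemma dualOptimal_eq_zero (hl : 0 < l) (hG : ∀ i ≤ k, 0 < G i) (hc : ∀ i ≤ k, G i ≤ c i)
    {x : ChainSpace.{u} k} {i : Fin (k + 1)} (hx : x ∈ chainSubspace.{u} k i)
    {α : Fin (k + 1) → ℝ}
    (hα : IsDualOptimal (slope.{u} G c) (fun j => offset G c l j) l x α) {j : Fin (k + 1)}
    (hij : i < j) : α j = 0 := by
  by_contra hαj
  have hαj0 : 0 < α j := lt_of_le_of_ne (hα.mem.1 j) (Ne.symm hαj)
  have hk : ∀ n : Fin (k + 1), (n : ℕ) ≤ k := fun n => Nat.lt_succ_iff.1 n.2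
  have hij' : (i : ℕ) < j := hij
  set w := x - (1 / l) • ∑ n, α n • slope.{u} G c n with hw
  have hwm : ∀ m : ULift.{u} (Fin (k + 1)), (i : ℕ) ≤ m.down →
      w m = 1 / l * ∑ n, α n * -slopeCoord G c n m.down := by
    intro m hm
    simp [hw, hx m hm, Finset.sum_neg_distrib]
  have hterm : ∀ (m : ULift.{u} (Fin (k + 1))) (n : Fin (k + 1)),
      0 ≤ α n * -slopeCoord G c n m.down := fun m n =>
    mul_nonneg (hα.mem.1 n) (neg_nonneg.2 (slopeCoord_nonpos hG hc (hk n)))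
  have hw0 : ∀ m : ULift.{u} (Fin (k + 1)), (i : ℕ) ≤ m.down → 0 ≤ w m := by
    intro m hm
    rw [hwm m hm]
    exact mul_nonneg (by positivity) (Finset.sum_nonneg fun n _ => hterm m n)
  have hwi : w ⟨i⟩ ≤ c i / l := by
    rw [hwm ⟨i⟩ le_rfl]
    have h1 : ∑ n, α n * -slopeCoord G c n i ≤ ∑ n, α n * c i :=
      Finset.sum_le_sum fun n _ => mul_le_mul_of_nonneg_left
        (by have := neg_le_slopeCoord (j := (n : ℕ)) hG hc (hk i); linarith) (hα.mem.1 n)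
    rw [← Finset.sum_mul, hα.mem.2, one_mul] at h1
    calc 1 / l * ∑ n, α n * -slopeCoord G c n i ≤ 1 / l * c i := by gcongr
      _ = c i / l := by ring
  have hwj : 0 < w ⟨j⟩ := by
    rw [hwm ⟨j⟩ hij'.le]
    refine mul_pos (by positivity) (Finset.sum_pos' (fun n _ => hterm ⟨j⟩ n)
      ⟨j, Finset.mem_univ j, ?_⟩)
    have h1 := hG j (hk j)
    have h2 := hc j (hk j)
    simp only [slopeCoord, lt_irrefl, if_false, if_true, neg_neg]
    exact mul_pos hαj0 (by linarith)
  have hinner : inner ℝ (slope.{u} G c j) w - inner ℝ (slope.{u} G c i) w <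
      (c i - G i) * c i / l := by
    rw [← inner_sub_left, PiLp.inner_apply]
    have hs : ∑ m : ULift.{u} (Fin (k + 1)), (if m = ⟨i⟩ then (c i - G i) * c i / l else 0) =
        (c i - G i) * c i / l := by simp
    rw [← hs]
    refine Finset.sum_lt_sum (fun m _ => ?_) ⟨⟨j⟩, Finset.mem_univ _, ?_⟩
    · obtain ⟨m⟩ := m
      simp only [PiLp.sub_apply, slope_apply, RCLike.inner_apply, conj_trivial, ULift.up_inj]
      rcases lt_trichotomy m i with h | rfl | h
      · have h1 : (m : ℕ) < i := h
        have h2 : (m : ℕ) < j := by omega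
        rw [if_neg h.ne]
        simp [slopeCoord, h1, h2]
      · rw [if_pos rfl]
        simp only [slopeCoord, hij', lt_irrefl, if_true, if_false]
        have := mul_le_mul_of_nonneg_left hwi (sub_nonneg.2 (hc m (hk m)))
        calc w ⟨m⟩ * (-G m - -c m) = (c m - G m) * w ⟨m⟩ := by ring
          _ ≤ (c m - G m) * (c m / l) := this
          _ = (c m - G m) * c m / l := by ring
      · have h1 : (i : ℕ) < m := h
        rw [if_neg h.ne']
        have h2 : slopeCoord G c i m = 0 := by
          simp [slopeCoord, h1.not_gt, h1.ne']
        rw [h2, sub_zero]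
        exact mul_nonpos_of_nonneg_of_nonpos (hw0 ⟨m⟩ h1.le) (slopeCoord_nonpos hG hc (hk j))
    · have h2 : slopeCoord G c i j = 0 := by
        simp [slopeCoord, hij'.not_gt, hij'.ne']
      simp only [PiLp.sub_apply, slope_apply, RCLike.inner_apply, conj_trivial, ULift.up_inj, h2,
        sub_zero]
      rw [if_neg hij.ne']
      refine mul_neg_of_pos_of_neg hwj ?_
      have h1 := hG j (hk j)
      have h2 := hc j (hk j)
      simp only [slopeCoord, lt_irrefl, if_false, if_true]
      linarith
  have hlt : pieceValue (slope.{u} G c) (fun j : Fin (k + 1) => offset G c l j) l x α j <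
      pieceValue (slope.{u} G c) (fun j : Fin (k + 1) => offset G c l j) l x α i := by
    have := offset_add_le_offset hl hG hc hij' (hk j)
    simp only [pieceValue, ← hw]
    linarith
  rw [hα.pieceValue_eq hαj] at hlt
  exact absurd (hα.le i) (not_le.2 hlt)

lemma smoothMaxGradient_mem_chainSubspace (hl : 0 < l) (hG : ∀ i ≤ k, 0 < G i)
    (hc : ∀ i ≤ k, G i ≤ c i) {i : ℕ} {x : ChainSpace.{u} k} (hx : x ∈ chainSubspace.{u} k i) :
    smoothMaxGradient (slope.{u} G c) (fun j : Fin (k + 1) => offset G c l j) l x ∈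
      chainSubspace.{u} k (i + 1) := by
  intro m hm
  have hmk := m.down.2
  have hik : i < k + 1 := by omega
  have h0 : ∀ j : Fin (k + 1), i < j →
      dualWeights (slope.{u} G c) (fun j : Fin (k + 1) => offset G c l j) l x j = 0 :=
    fun j hj => dualOptimal_eq_zero hl hG hc (i := ⟨i, hik⟩) hx
      (isDualOptimal_dualWeights _ _ _ _) hj
  simp only [smoothMaxGradient, WithLp.ofLp_sum, Finset.sum_apply, PiLp.smul_apply, slope_apply,
    smul_eq_mul]
  refine Finset.sum_eq_zero fun j _ => ?_
  rcases lt_or_ge i (j : ℕ) with hj | hj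
  · rw [h0 j hj, zero_mul]
  · have h1 : ¬ (m.down : ℕ) < j := by omega
    have h2 : ¬ (m.down : ℕ) = j := by omega
    simp [slopeCoord, h1, h2]

lemma sum_slopeCoord_mul {j : ℕ} (hj : j ≤ k) :
    ∑ m ∈ Finset.range (k + 1), slopeCoord G c j m * G m =
      -(∑ m ∈ Finset.range j, G m ^ 2 + c j * G j) := by
  rw [← Finset.sum_subset (Finset.range_subset_range.2 (Nat.succ_le_succ hj)),
    Finset.sum_range_succ]
  · have : ∑ m ∈ Finset.range j, slopeCoord G c j m * G m = ∑ m ∈ Finset.range j, -G m ^ 2 := by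
      refine Finset.sum_congr rfl fun m hm => ?_
      rw [slopeCoord, if_pos (Finset.mem_range.1 hm)]
      ring
    rw [this, Finset.sum_neg_distrib]
    simp [slopeCoord]
    ring
  · intro m _ hm
    have hm : j < m := by simpa using hm
    simp [slopeCoord, hm.not_gt, hm.ne']

lemma sum_chain_eq_sum_range (F : ℕ → ℝ) :
    ∑ m : ULift.{u} (Fin (k + 1)), F m.down = ∑ m ∈ Finset.range (k + 1), F m := by
  rw [← Fin.sum_univ_eq_sum_range]
  exact Fintype.sum_equiv Equiv.ulift _ _ fun _ => rfl

/-- The minimizer of the resisting function: all pieces are active there, and the last one alone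
carries the weight. -/
noncomputable def chainMinimizer (μ : ℝ) (G c : ℕ → ℝ) (k : ℕ) : ChainSpace.{u} k :=
  -(1 / μ) • slope.{u} G c (Fin.last k)

lemma slopeCoord_last (hck : c k = G k) {m : ℕ} (hm : m ≤ k) : slopeCoord G c k m = -G m := by
  rcases hm.lt_or_eq with h | rfl
  · simp [slopeCoord, h]
  · simp [slopeCoord, hck]

lemma chainMinimizer_apply {μ : ℝ} (hck : c k = G k) (m : ULift.{u} (Fin (k + 1))) :
    chainMinimizer.{u} μ G c k m = 1 / μ * G m.down := by
  have hm : (m.down : ℕ) ≤ k := Nat.lt_succ_iff.1 m.down.2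
  simp [chainMinimizer, slopeCoord_last hck hm]

lemma isDualOptimal_chainMinimizer {μ : ℝ} (hμ : 0 < μ) (hl : 0 < l) (hck : c k = G k)
    (hrec : ∀ i < k, c (i + 1) * G (i + 1) = (c i - G i) * (G i - μ / (μ + l) * c i)) :
    IsDualOptimal (slope.{u} G c) (fun j : Fin (k + 1) => offset G c l j) l
      (chainMinimizer.{u} μ G c k) (Pi.single (Fin.last k) 1) := by
  -- by the recursion, all pieces have the same value at the proximal point
  have hval : ∀ j : Fin (k + 1), pieceValue (slope.{u} G c)
      (fun j : Fin (k + 1) => offset G c l j) l (chainMinimizer.{u} μ G c k)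
      (Pi.single (Fin.last k) 1) j = -(1 / μ + 1 / l) *
        (∑ m ∈ Finset.range j, G m ^ 2 + c j * G j) - offset G c l j := by
    intro j
    have hsum : ∑ i, (Pi.single (Fin.last k) 1 : Fin (k + 1) → ℝ) i • slope.{u} G c i =
        slope.{u} G c (Fin.last k) := by simp [Pi.single_apply]
    rw [pieceValue, hsum, chainMinimizer, PiLp.inner_apply, neg_mul, ← mul_neg,
      ← sum_slopeCoord_mul (Nat.lt_succ_iff.1 j.2), ← sum_chain_eq_sum_range.{u}, Finset.mul_sum]
    congr 1
    refine Finset.sum_congr rfl fun m _ => ?_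
    have hm : (m.down : ℕ) ≤ k := Nat.lt_succ_iff.1 m.down.2
    simp [slopeCoord_last hck hm]
    ring
  have hstep : ∀ j, j ≤ k → -(1 / μ + 1 / l) * (∑ m ∈ Finset.range j, G m ^ 2 + c j * G j) -
      offset G c l j = -(1 / μ + 1 / l) * (c 0 * G 0) := by
    intro j
    induction j with
    | zero => simp [offset]
    | succ j ih =>
      intro hj
      rw [← ih (by omega), Finset.sum_range_succ, hrec j (by omega), offset, offset,
        Finset.sum_range_succ]
      field_simp
      ring
  refine ⟨single_mem_stdSimplex ℝ _, fun j => ?_⟩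
  have h1 : ∑ i, (Pi.single (Fin.last k) 1 : Fin (k + 1) → ℝ) i * pieceValue (slope.{u} G c)
      (fun j : Fin (k + 1) => offset G c l j) l (chainMinimizer.{u} μ G c k)
      (Pi.single (Fin.last k) 1) i = -(1 / μ + 1 / l) * (c 0 * G 0) := by
    have h2 := (hval (Fin.last k)).trans (hstep k le_rfl)
    simp [Pi.single_apply] at h2 ⊢
    exact h2
  rw [h1, hval, hstep j (Nat.lt_succ_iff.1 j.2)]

lemma isSolution_chainMinimizer {μ : ℝ} (hμ : 0 < μ) (hl : 0 < l) (hck : c k = G k)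
    (hrec : ∀ i < k, c (i + 1) * G (i + 1) = (c i - G i) * (G i - μ / (μ + l) * c i)) :
    IsSolution (fun x : ChainSpace.{u} k => μ / 2 * ‖x‖ ^ 2 +
      smoothMax (slope.{u} G c) (fun j : Fin (k + 1) => offset G c l j) l x)
      (fun _ => 0) (chainMinimizer.{u} μ G c k) := by
  intro x _
  simp only [mem_ofPred_eq, add_zero, EReal.coe_le_coe_iff]
  rw [smoothMax_eq hl (isDualOptimal_chainMinimizer hμ hl hck hrec)]
  have h1 := dualValue_le_smoothMax (a := slope.{u} G c)
    (b := fun j : Fin (k + 1) => offset G c l j) hl x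
    (single_mem_stdSimplex ℝ (Fin.last k))
  have h2 : ∀ y : ChainSpace.{u} k, dualValue (slope.{u} G c)
      (fun j : Fin (k + 1) => offset G c l j) l y (Pi.single (Fin.last k) 1) =
      inner ℝ (slope.{u} G c (Fin.last k)) y - offset G c l k -
        1 / (2 * l) * ‖slope.{u} G c (Fin.last k)‖ ^ 2 := by
    intro y
    simp [dualValue, Pi.single_apply]
  rw [h2] at h1 ⊢
  set a := slope.{u} G c (Fin.last k) with ha
  have h3 : 0 ≤ μ / 2 * ‖x + (1 / μ) • a‖ ^ 2 := by positivity
  have h4 : μ / 2 * ‖x + (1 / μ) • a‖ ^ 2 =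
      μ / 2 * ‖x‖ ^ 2 + inner ℝ a x + 1 / (2 * μ) * ‖a‖ ^ 2 := by
    rw [norm_add_sq_real, real_inner_smul_right, real_inner_comm, norm_smul, mul_pow,
      Real.norm_eq_abs, sq_abs]
    field_simp
  have h5 : μ / 2 * ‖chainMinimizer.{u} μ G c k‖ ^ 2 +
      inner ℝ a (chainMinimizer.{u} μ G c k) = -(1 / (2 * μ) * ‖a‖ ^ 2) := by
    rw [chainMinimizer, ← ha, norm_smul, mul_pow, real_inner_smul_right,
      real_inner_self_eq_norm_sq, Real.norm_eq_abs, sq_abs]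
    field_simp
    ring
  linarith

lemma norm_chainMinimizer_sq {μ : ℝ} (hck : c k = G k) :
    ‖chainMinimizer.{u} μ G c k‖ ^ 2 =
      (1 / μ) ^ 2 * ∑ m ∈ Finset.range (k + 1), G m ^ 2 := by
  rw [EuclideanSpace.norm_sq_eq, ← sum_chain_eq_sum_range.{u}, Finset.mul_sum]
  refine Finset.sum_congr rfl fun m _ => ?_
  rw [chainMinimizer_apply hck, Real.norm_eq_abs, sq_abs, mul_pow]

/-- Every method with `k` gradient calls misses the last coordinate of the minimizer. -/
lemma le_risk_of_chain {μ : ℝ} (hμ : 0 < μ) (hl : 0 < l) (hG : ∀ i ≤ k, 0 < G i)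
    (hc : ∀ i ≤ k, G i ≤ c i) (hck : c k = G k)
    (hrec : ∀ i < k, c (i + 1) * G (i + 1) = (c i - G i) * (G i - μ / (μ + l) * c i))
    {A : Method.{u}} (hA : A ∈ spanMethods.{u} k μ (μ + l)) :
    ENNReal.ofReal (G k ^ 2 / ∑ m ∈ Finset.range (k + 1), G m ^ 2) ≤ risk.{u} μ (μ + l) A := by
  let f : ChainSpace.{u} k → ℝ := fun x => μ / 2 * ‖x‖ ^ 2 +
    smoothMax (slope.{u} G c) (fun j : Fin (k + 1) => offset G c l j) l x
  let us : ChainSpace.{u} k := chainMinimizer.{u} μ G c k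
  have hint := smoothMax_interpolation (slope.{u} G c) (fun j : Fin (k + 1) => offset G c l j) l
  have hf : SmoothStronglyConvex μ (μ + l) f := smoothStronglyConvex_quadratic_add hμ.le hl hint
  have hgrad : ∀ x, gradient f x = μ • x +
      smoothMaxGradient (slope.{u} G c) (fun j : Fin (k + 1) => offset G c l j) l x := fun x =>
    (hasGradientAt_quadratic_add (hasGradientAt_of_interpolation hl hint) x).gradient
  have hmem : A (ChainSpace.{u} k) f (fun _ => 0) 0 ∈ chainSubspace.{u} k k := by
    refine mem_of_spanReachable monotone_chainSubspace (fun i x hx => ?_)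
      (hA _ f (fun _ => 0) 0 hf convexProperLsc_zero)
    rw [hgrad]
    exact add_mem (Submodule.smul_mem _ _ (monotone_chainSubspace (Nat.le_succ i) hx))
      (smoothMaxGradient_mem_chainSubspace hl hG hc hx)
  have hsum : 0 < ∑ m ∈ Finset.range (k + 1), G m ^ 2 := by
    refine Finset.sum_pos (fun m hm => ?_) ⟨0, by simp⟩
    have := hG m (Nat.lt_succ_iff.1 (Finset.mem_range.1 hm))
    positivity
  have hnorm : 0 < ‖us‖ ^ 2 := by
    rw [norm_chainMinimizer_sq hck]; positivity
  have hne : (0 : ChainSpace.{u} k) ≠ us := by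
    intro h
    rw [← h] at hnorm
    simp at hnorm
  refine le_sSup_of_le ⟨ChainSpace.{u} k, inferInstance, inferInstance, inferInstance, f,
    fun _ => 0, us, 0, hf, convexProperLsc_zero, isSolution_chainMinimizer hμ hl hck hrec, hne,
    rfl⟩ (ENNReal.ofReal_le_ofReal ?_)
  set p := A (ChainSpace.{u} k) f (fun _ => 0) 0 with hp
  have h1 : (1 / μ * G k) ^ 2 ≤ ‖p - us‖ ^ 2 := by
    have h2 := PiLp.norm_apply_le (p - us) ⟨Fin.last k⟩
    have h3 : (p - us) ⟨Fin.last k⟩ = -(1 / μ * G k) := by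
      rw [PiLp.sub_apply, hmem ⟨Fin.last k⟩ (by simp), chainMinimizer_apply hck]
      simp
    rw [h3, norm_neg, Real.norm_eq_abs] at h2
    rw [← sq_abs]
    exact pow_le_pow_left₀ (abs_nonneg _) h2 2
  rw [zero_sub, norm_neg, le_div_iff₀ hnorm, norm_chainMinimizer_sq hck]
  refine le_trans (le_of_eq ?_) h1
  field_simp

end Chain

/-! ### Tuning the resisting instance -/

section Tuning

/-- The weights of the resisting instance. With `τ i = q * δ i` the `i`-th squared coordinate of the
minimizer is proportional to `chainWeight q i * τ i`, except for the last one. -/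
noncomputable def chainWeight (q : ℝ) : ℕ → ℝ
  | 0 => 1
  | i + 1 => chainWeight q i * ((1 - 1 / seqDelta q i) * (1 - q * seqDelta q i))

/-- The ratio `G i / c i` of the resisting instance with `k` gradient calls. -/
noncomputable def chainRatio (q : ℝ) (k i : ℕ) : ℝ := if i = k then 1 else q * seqDelta q i

variable {q : ℝ}

lemma chainWeight_pos (hq0 : 0 < q) (hq1 : q < 1) (i : ℕ) : 0 < chainWeight q i := by
  induction i with
  | zero => exact one_pos
  | succ i ih =>
    have h1 := one_lt_seqDelta hq0 hq1 i
    have h2 := mul_seqDelta_lt_one hq0 hq1 i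
    have h3 : 1 / seqDelta q i < 1 := (div_lt_one (by linarith)).2 h1
    exact mul_pos ih (mul_pos (by linarith) (by linarith))

/-- The partial sums of the squared coordinates are governed by the sequence `A`. -/
lemma sum_chainWeight (hq0 : 0 < q) (hq1 : q < 1) (k : ℕ) :
    ∑ i ∈ Finset.range k, chainWeight q i * (q * seqDelta q i) =
      q * seqA q k * chainWeight q k := by
  induction k with
  | zero => simp [seqA]
  | succ k ih =>
    have h1 := one_lt_seqDelta hq0 hq1 k
    have h2 := seqDelta_sq hq0 k
    have h3 := two_mul_seqDelta hq0 hq1 k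
    have h0 : seqDelta q k ≠ 0 := by linarith
    rw [Finset.sum_range_succ, ih, chainWeight]
    set δ := seqDelta q k
    set A' := seqA q (k + 1)
    have h4 : (seqA q k + δ) * δ = A' * ((δ - 1) * (1 - q * δ)) := by
      linear_combination δ * h3 - h2
    have h5 : A' * ((1 - 1 / δ) * (1 - q * δ)) = seqA q k + δ := by
      field_simp
      linear_combination -h4
    linear_combination (-q * chainWeight q k) * h5

lemma le_risk {μ L : ℝ} (hμ : 0 < μ) (hμL : μ < L) (k : ℕ) {A : Method.{u}}
    (hA : A ∈ spanMethods.{u} k μ L) :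
    ENNReal.ofReal (1 / (1 + μ / L * seqA (μ / L) k)) ≤ risk.{u} μ L A := by
  have hL : 0 < L := hμ.trans hμL
  obtain ⟨q, hq⟩ : ∃ q, q = μ / L := ⟨_, rfl⟩
  have hq0 : 0 < q := hq ▸ div_pos hμ hL
  have hq1 : q < 1 := hq ▸ (div_lt_one hL).2 hμL
  have hl : 0 < L - μ := sub_pos.2 hμL
  have hτ0 : ∀ i, 0 < chainRatio q k i := by
    intro i
    unfold chainRatio
    split_ifs
    · exact one_pos
    · exact mul_pos hq0 (zero_lt_one.trans (one_lt_seqDelta hq0 hq1 i))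
  have hτ1 : ∀ i, chainRatio q k i ≤ 1 := by
    intro i
    unfold chainRatio
    split_ifs
    · exact le_rfl
    · exact (mul_seqDelta_lt_one hq0 hq1 i).le
  let G : ℕ → ℝ := fun i => √(chainWeight q i * chainRatio q k i)
  let c : ℕ → ℝ := fun i => G i / chainRatio q k i
  have hG : ∀ i, 0 < G i := fun i => Real.sqrt_pos.2 (mul_pos (chainWeight_pos hq0 hq1 i) (hτ0 i))
  have hGsq : ∀ i, G i ^ 2 = chainWeight q i * chainRatio q k i := fun i =>
    Real.sq_sqrt (mul_pos (chainWeight_pos hq0 hq1 i) (hτ0 i)).le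
  have hcG : ∀ i, c i * G i = chainWeight q i := by
    intro i
    have := (hτ0 i).ne'
    simp only [c]
    rw [div_mul_eq_mul_div, ← pow_two, hGsq, mul_div_cancel_right₀ _ this]
  have hchain : ENNReal.ofReal (G k ^ 2 / ∑ m ∈ Finset.range (k + 1), G m ^ 2) ≤
      risk.{u} μ (μ + (L - μ)) A := by
    refine le_risk_of_chain (c := c) hμ hl (fun i _ => hG i) (fun i _ => ?_) ?_ (fun i hi => ?_)
      (by rwa [add_sub_cancel])
    · exact (le_div_iff₀ (hτ0 i)).2 (mul_le_of_le_one_right (hG i).le (hτ1 i))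
    · simp [c, chainRatio]
    · have hτ : chainRatio q k i = q * seqDelta q i := by simp [chainRatio, hi.ne]
      have hδ : seqDelta q i ≠ 0 := (zero_lt_one.trans (one_lt_seqDelta hq0 hq1 i)).ne'
      rw [hcG, add_sub_cancel, ← hq, chainWeight]
      have h1 : chainWeight q i = G i ^ 2 / (q * seqDelta q i) := by
        rw [hGsq, hτ]; field_simp
      simp only [c, hτ]
      rw [h1]
      field_simp
  rw [add_sub_cancel] at hchain
  convert hchain using 2
  have hsum : ∑ m ∈ Finset.range (k + 1), G m ^ 2 = (1 + q * seqA q k) * chainWeight q k := by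
    rw [Finset.sum_range_succ, hGsq, add_mul, ← sum_chainWeight hq0 hq1]
    have : ∑ i ∈ Finset.range k, G i ^ 2 =
        ∑ i ∈ Finset.range k, chainWeight q i * (q * seqDelta q i) := by
      refine Finset.sum_congr rfl fun i hi => ?_
      rw [hGsq, chainRatio, if_neg (Finset.mem_range.1 hi).ne]
    rw [this, chainRatio, if_pos rfl]
    ring
  have hw := (chainWeight_pos hq0 hq1 k).ne'
  rw [hsum, hGsq, chainRatio, if_pos rfl, mul_one, ← hq]
  field_simp

end Tuning

end ProxItem

theorem mainTheorem2 (μ L : ℝ) (hμ : 0 < μ) (hμL : μ < L) (k : ℕ) :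
    (⨅ A ∈ ProxItem.spanMethods.{u} k μ L, ProxItem.risk.{u} μ L A) =
        ENNReal.ofReal (1 / (1 + μ / L * ProxItem.seqA (μ / L) k)) ∧
      ProxItem.proxItem.{u} μ L k ∈ ProxItem.spanMethods.{u} k μ L ∧
      ProxItem.risk.{u} μ L (ProxItem.proxItem.{u} μ L k) =
        ⨅ A ∈ ProxItem.spanMethods.{u} k μ L, ProxItem.risk.{u} μ L A := by
  have hmem := ProxItem.proxItem_mem_spanMethods.{u} hμ hμL k
  have hupper := ProxItem.risk_proxItem_le.{u} hμ hμL k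
  have hlower : ENNReal.ofReal (1 / (1 + μ / L * ProxItem.seqA (μ / L) k)) ≤
      ⨅ A ∈ ProxItem.spanMethods.{u} k μ L, ProxItem.risk.{u} μ L A :=
    le_iInf₂ fun _ hA => ProxItem.le_risk hμ hμL k hA
  have hinf : (⨅ A ∈ ProxItem.spanMethods.{u} k μ L, ProxItem.risk.{u} μ L A) ≤
      ProxItem.risk.{u} μ L (ProxItem.proxItem.{u} μ L k) := iInf₂_le _ hmem
  exact ⟨le_antisymm (hinf.trans hupper) hlower, hmem,
    le_antisymm (hupper.trans hlower) hinf⟩
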